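/- Let $S$ be a locally compact Hausdorff topological $*$-semigroup: a semigroup with a jointly continuous product and a continuous involution satisfying $(xy)^*=y^*x^*$, $x^{**}=x$. Let $M(S)$ be the space of bounded regular complex Borel measures on $S$ with the total variation norm, the convolution $\int f\,d(\mu*\nu)=\int\!\int f(xy)\,d\mu(x)\,d\nu(y)$ $(f\in C_0(S))$ and the involution $\mu^*(A)=\overline{\mu(A^*)}$, and let $L(S)$ be the $*$-subalgebra of all $\mu\in M(S)$ for which $x\mapsto|\mu|*\delta_x$ and $x\mapsto\delta_x*|\mu|$ are continuous from $S$ to $M(S)$ with its weak topology. Let $\Sigma$ be the family of all $*$-representations $\pi$ of $S$ on Hilbert spaces $H_\pi$ with $\|\pi(x)\|\le 1$ for all $x\in S$ and with $x\mapsto\langle\pi(x)\xi,\eta\rangle$ continuous for all $\xi,\eta\in H_\pi$. For $\pi\in\Sigma$ and $\mu\in M(S)$ let $\tilde\pi(\mu)$ be the operator on $H_\pi$ with $\langle\tilde\pi(\mu)\xi,\eta\rangle=\int_S\langle\pi(x)\xi,\eta\rangle\,d\mu(x)$. For $\rho\subseteq\Sigma$ put $\|\mu\|_\rho=\sup_{\pi\in\rho}\|\tilde\pi(\mu)\|$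 (which is $0$ if $\rho=\emptyset$) and $N_\rho=\{\mu\in L(S):\|\mu\|_\rho=0\}$, and let the $C^*$-algebra $C^*_\rho(S)$ be the completion of $L(S)/N_\rho$ in the norm $\|\mu+N_\rho\|=\|\mu\|_\rho$. Put $C^*(S)=C^*_\Sigma(S)$ and let $\iota:L(S)\to C^*(S)$ be the canonical map. Each $\tilde\pi$ $(\pi\in\Sigma)$ extends to a $*$-representation of $C^*(S)$, again written $\tilde\pi$, with $\tilde\pi(\iota(\mu))=\tilde\pi(\mu)$. For $\rho\subseteq\Sigma$ let $$N'_\rho=\bigcap_{\pi\in\rho}\ker\tilde\pi\subseteq C^*(S).$$ Then $\iota(N_\rho)\subseteq N'_\rho$, and there is a continuous surjective $*$-homomorphism $\varphi:C^*(S)\to C^*_\rho(S)$ with $\varphi(\iota(\mu))=\mu+N_\rho$ for all $\mu\in L(S)$ and with kernel $N'_\rho$. It is the only $*$-homomorphism, and also the only continuous map, from $C^*(S)$ to $C^*_\rho(S)$ that extends $\mu\mapsto\mu+N_\rho$ in this sense. The map $g+N'_\rho\mapsto\varphi(g)$ is an isometric isomorphism from $C^*(S)/N'_\rho$ with the quotient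 norm onto $C^*_\rho(S)$. -/

import Mathlib

open MeasureTheory Filter Topology
open scoped ENNReal NNReal CompactlySupported ZeroAtInfty ComplexConjugate

set_option linter.unusedSectionVars false

noncomputable section

namespace FoundationSemigroup

section Measures

variable {X : Type*} [MeasurableSpace X]

/-- The integral of a complex function against a complex measure. -/
def cint (μ : ComplexMeasure X) (f : X → ℂ) : ℂ :=
  μ.integral f (ContinuousLinearMap.mul ℝ ℂ)

/-- A finite positive measure, seen as a complex measure. -/
def toC (n : Measure X) [IsFiniteMeasure n] : ComplexMeasure X :=
  n.toSignedMeasure.toComplexMeasure 0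

theorem toC_apply (n : Measure X) [IsFiniteMeasure n] {A : Set X} (hA : MeasurableSet A) :
    toC n A = (n.real A : ℂ) := by
  apply Complex.ext <;>
    simp [toC, SignedMeasure.toComplexMeasure_apply, Measure.toSignedMeasure_apply_measurable hA]

theorem toC_add (m n : Measure X) [IsFiniteMeasure m] [IsFiniteMeasure n] :
    toC (m + n) = toC m + toC n := by
  ext A hA
  simp [toC_apply _ hA, measureReal_add_apply]

theorem variation_toC (n : Measure X) [IsFiniteMeasure n] : (toC n).variation = n := by
  have h0 : ∀ A, MeasurableSet A → ‖toC n A‖ₑ = n A := by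
    intro A hA
    rw [toC_apply n hA, ← ofReal_norm, Complex.norm_real, Real.norm_of_nonneg measureReal_nonneg,
      ofReal_measureReal]
  refine le_antisymm (VectorMeasure.variation_le_of_forall_enorm_le fun A hA => (h0 A hA).le) ?_
  refine Measure.le_intro fun A hA _ => ?_
  rw [← h0 A hA]
  exact VectorMeasure.enorm_measure_le_variation _ _

instance finite_variation (μ : ComplexMeasure X) : IsFiniteMeasure μ.variation := by
  have h : μ.variation ≤ (ComplexMeasure.re μ).totalVariation
      + (ComplexMeasure.im μ).totalVariation := by
    refine VectorMeasure.variation_le_of_forall_enorm_le fun A hA => ?_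
    rw [Measure.add_apply]
    refine le_trans ?_ (add_le_add (SignedMeasure.enorm_le_totalVariation _ A)
      (SignedMeasure.enorm_le_totalVariation _ A))
    rw [← ofReal_norm, ← ofReal_norm, ← ofReal_norm,
      ← ENNReal.ofReal_add (norm_nonneg _) (norm_nonneg _)]
    exact ENNReal.ofReal_le_ofReal (Complex.norm_le_abs_re_add_abs_im _)
  exact isFiniteMeasure_of_le _ h

theorem cint_toC (n : Measure X) [IsFiniteMeasure n] (f : X → ℂ) :
    cint (toC n) f = ∫ x, f x ∂n := by
  rw [cint, VectorMeasure.integral_eq_setToFun, MeasureTheory.integral_eq_setToFun]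
  simp only [variation_toC]
  apply setToFun_congr_left' _ _ (fun s hs h's ↦ ?_)
  ext x
  simp [VectorMeasure.transpose, toC_apply n hs, weightedSMul, mul_comm]

theorem cint_add (μ ν : ComplexMeasure X) {f : X → ℂ} (hμ : Integrable f μ.variation)
    (hν : Integrable f ν.variation) : cint (μ + ν) f = cint μ f + cint ν f :=
  VectorMeasure.integral_add_vectorMeasure hμ hν

theorem cint_smul (c : ℂ) (μ : ComplexMeasure X) {f : X → ℂ} (hf : Integrable f μ.variation) :
    cint (c • μ) f = c * cint μ f := by
  have hdom := dominatedFinMeasAdditive_cbmApplyMeasure (c • μ)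
    (ContinuousLinearMap.mul ℝ ℂ)
  have hT : DominatedFinMeasAdditive μ.variation
      ((c • μ).transpose (ContinuousLinearMap.mul ℝ ℂ)) (‖c‖ * ‖ContinuousLinearMap.mul ℝ ℂ‖) := by
    refine ⟨fun s t hs ht _ _ hd => hdom.1 s t hs ht (measure_ne_top _ _) (measure_ne_top _ _) hd,
      fun s hs hsf => ?_⟩
    have := hdom.2 s hs (measure_lt_top _ _)
    rw [VectorMeasure.variation_smul] at this
    simp only [measureReal_def, Measure.smul_apply] at this ⊢
    rw [ENNReal.smul_def, smul_eq_mul, ENNReal.toReal_mul] at this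
    simpa [mul_comm, mul_left_comm, mul_assoc] using this
  have key : ∀ f : X → ℂ, Integrable f μ.variation →
      setToFun μ.variation _ hT f = c * cint μ f := by
    intro f hf
    refine Integrable.induction (fun f => setToFun μ.variation _ hT f = c * cint μ f)
      ?_ ?_ ?_ ?_ hf
    · intro a s hs hμs
      rw [cint, VectorMeasure.integral_eq_setToFun, setToFun_indicator_const _ hs hμs.ne,
        setToFun_indicator_const _ hs hμs.ne]
      simp [VectorMeasure.transpose]
      ring
    · intro f g _ hf hg h1 h2
      rw [setToFun_add hT hf hg, h1, h2, cint, cint, cint, VectorMeasure.integral_add hf hg,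
        mul_add]
    · exact isClosed_eq (continuous_setToFun hT)
        (continuous_const.mul VectorMeasure.continuous_integral)
    · intro f g hfg _ h
      rw [← setToFun_congr_ae hT hfg, h, cint, cint, VectorMeasure.integral_congr_ae hfg]
  rw [← key f hf, cint, VectorMeasure.integral_eq_setToFun]
  refine (setToFun_congr_measure_of_integrable (‖c‖₊ : ℝ≥0∞) (by simp) ?_ hT _ f hf).symm
  rw [VectorMeasure.variation_smul]; rfl

/-- The four positive parts of a complex measure. -/
theorem exists_decomp (μ : ComplexMeasure X) :
    ∃ m : Fin 4 → Measure X, ∃ _ : ∀ i, IsFiniteMeasure (m i), (∀ i, m i ≤ μ.variation) ∧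
      μ = toC (m 0) - toC (m 1) + Complex.I • (toC (m 2) - toC (m 3)) := by
  have hre : (ComplexMeasure.re μ).totalVariation ≤ μ.variation := by
    rw [SignedMeasure.totalVariation_eq_variation]
    refine VectorMeasure.variation_le_of_forall_enorm_le fun A hA =>
      le_trans ?_ (VectorMeasure.enorm_measure_le_variation μ A)
    rw [← ofReal_norm, ← ofReal_norm]
    exact ENNReal.ofReal_le_ofReal (Complex.abs_re_le_norm _)
  have him : (ComplexMeasure.im μ).totalVariation ≤ μ.variation := by
    rw [SignedMeasure.totalVariation_eq_variation]
    refine VectorMeasure.variation_le_of_forall_enorm_le fun A hA =>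
      le_trans ?_ (VectorMeasure.enorm_measure_le_variation μ A)
    rw [← ofReal_norm, ← ofReal_norm]
    exact ENNReal.ofReal_le_ofReal (Complex.abs_im_le_norm _)
  refine ⟨![(ComplexMeasure.re μ).toJordanDecomposition.posPart,
    (ComplexMeasure.re μ).toJordanDecomposition.negPart,
    (ComplexMeasure.im μ).toJordanDecomposition.posPart,
    (ComplexMeasure.im μ).toJordanDecomposition.negPart], ?_, ?_, ?_⟩
  · intro i
    fin_cases i <;> simp <;> infer_instance
  · intro i
    fin_cases i
    · exact le_trans (Measure.le_add_right le_rfl) hre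
    · exact le_trans (Measure.le_add_left le_rfl) hre
    · exact le_trans (Measure.le_add_right le_rfl) him
    · exact le_trans (Measure.le_add_left le_rfl) him
  · ext A hA
    have h1 := (ComplexMeasure.re μ).apply_eq_posPart_real_sub_negPart_real hA
    have h2 := (ComplexMeasure.im μ).apply_eq_posPart_real_sub_negPart_real hA
    have e1 : (ComplexMeasure.re μ) A = (μ A).re := rfl
    have e2 : (ComplexMeasure.im μ) A = (μ A).im := rfl
    rw [e1] at h1
    rw [e2] at h2
    apply Complex.ext
    · simp [toC_apply _ hA, h1]
    · simp [toC_apply _ hA, h2]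

end Measures

section Radon

variable {X : Type*} [MeasurableSpace X] [TopologicalSpace X] [BorelSpace X]
  [T2Space X]

theorem regular_of_ac {m n : Measure X} [IsFiniteMeasure m] [IsFiniteMeasure n] [m.Regular]
    (h : n ≪ m) : n.Regular := by
  have : n.InnerRegularCompactLTTop := by
    refine ⟨fun A hA r hr => ?_⟩
    have hK : ∀ k : ℕ, ∃ K, K ⊆ A ∧ IsCompact K ∧ m (A \ K) < ((k : ℝ≥0∞) + 1)⁻¹ := fun k =>
      hA.1.exists_isCompact_sdiff_lt (measure_ne_top m A) (by simp)
    choose K hKA hKc hKm using hK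
    have hmeas : ∀ k, MeasurableSet (K k) := fun k => (hKc k).measurableSet
    have h0 : m (A \ ⋃ k, K k) = 0 := by
      have hle : ∀ k : ℕ, m (A \ ⋃ k, K k) ≤ ((k : ℝ≥0∞) + 1)⁻¹ := fun k =>
        (measure_mono (Set.sdiff_subset_sdiff_right (Set.subset_iUnion K k))).trans (hKm k).le
      have ht : Tendsto (fun k : ℕ => ((k : ℝ≥0∞) + 1)⁻¹) atTop (𝓝 0) := by
        have := (ENNReal.tendsto_inv_nat_nhds_zero).comp (tendsto_add_atTop_nat 1)
        simpa [Function.comp_def] using this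
      exact le_antisymm (ge_of_tendsto' ht hle) bot_le
    have h1 : n (A \ ⋃ k, K k) = 0 := h h0
    have h2 : n A = n (⋃ k, K k) := by
      refine le_antisymm ?_ (measure_mono (Set.iUnion_subset hKA))
      calc n A ≤ n ((A \ ⋃ k, K k) ∪ ⋃ k, K k) := measure_mono (by simp)
        _ ≤ n (A \ ⋃ k, K k) + n (⋃ k, K k) := measure_union_le _ _
        _ = n (⋃ k, K k) := by rw [h1, zero_add]
    have h3 := tendsto_measure_iUnion_accumulate (μ := n) (f := K)
    rw [← h2] at h3
    obtain ⟨k, hk⟩ := ((tendsto_order.1 h3).1 r hr).exists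
    refine ⟨Set.accumulate K k, ?_, ?_, hk⟩
    · exact Set.iUnion₂_subset fun i _ => hKA i
    · exact (Set.finite_le_nat k).isCompact_biUnion fun i _ => hKc i
  infer_instance

theorem regular_of_le {m n : Measure X} [IsFiniteMeasure m] [m.Regular]
    (h : n ≤ m) : n.Regular := by
  have := isFiniteMeasure_of_le m h
  exact regular_of_ac (Measure.absolutelyContinuous_of_le h)

theorem regular_add {m n : Measure X} [IsFiniteMeasure m] [IsFiniteMeasure n] [m.Regular]
    [n.Regular] : (m + n).Regular := by
  have h1 : m.InnerRegular := inferInstance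
  have h2 : n.InnerRegular := inferInstance
  have h3 : (m + n).InnerRegular := inferInstance
  infer_instance

theorem regular_map {m : Measure X} [IsFiniteMeasure m] [m.Regular] {Y : Type*}
    [MeasurableSpace Y] [TopologicalSpace Y] [BorelSpace Y] [T2Space Y] {g : X → Y}
    (hg : Continuous g) : (m.map g).Regular := by
  have h1 : m.InnerRegular := inferInstance
  have h2 : (m.map g).InnerRegular := h1.map_of_continuous hg
  infer_instance

theorem regular_dirac (x : X) : (Measure.dirac x).Regular := by
  have : (Measure.dirac x).InnerRegularCompactLTTop := by
    refine ⟨fun A hA r hr => ?_⟩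
    by_cases hx : x ∈ A
    · refine ⟨{x}, by simpa using hx, isCompact_singleton, ?_⟩
      rw [Measure.dirac_apply' _ hA.1] at hr
      simpa [hx] using hr
    · rw [Measure.dirac_apply' _ hA.1] at hr
      simp [hx] at hr
  infer_instance

theorem integrable_of_bdd {m : Measure X} [IsFiniteMeasure m] {E : Type*} [NormedAddCommGroup E]
    [SecondCountableTopologyEither X E] {f : X → E} (hf : Continuous f) {C : ℝ}
    (hC : ∀ x, ‖f x‖ ≤ C) : Integrable f m :=
  Integrable.of_bound hf.aestronglyMeasurable C (Eventually.of_forall hC)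

variable [LocallyCompactSpace X]

theorem exists_cutoff (m : Measure X) [IsFiniteMeasure m] [m.Regular] {K₀ : Set X}
    (hK₀ : IsCompact K₀) {ε : ℝ} (hε : 0 < ε) :
    ∃ a : C(X, ℝ), HasCompactSupport a ∧ (∀ x, 0 ≤ a x ∧ a x ≤ 1) ∧ (∀ x ∈ K₀, a x = 1) ∧
      ∫ x, (1 - a x) ∂m ≤ ε := by
  obtain ⟨K, -, hK, hKm⟩ := (MeasurableSet.univ (α := X)).exists_isCompact_sdiff_lt
    (measure_ne_top m Set.univ) (ε := ENNReal.ofReal ε) (by simpa using hε)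
  obtain ⟨a, ha1, -, hac, ha⟩ := exists_continuous_one_zero_of_isCompact (hK.union hK₀)
    (isClosed_empty) (Set.disjoint_empty _)
  refine ⟨a, hac, fun x => ha x, fun x hx => ha1 (Or.inr hx), ?_⟩
  calc ∫ x, (1 - a x) ∂m ≤ ∫ x, (Set.univ \ K).indicator (fun _ => (1 : ℝ)) x ∂m := by
        refine integral_mono ?_ ?_ fun x => ?_
        · exact integrable_of_bdd (C := 1) (by fun_prop) fun x => by
            rw [Real.norm_eq_abs, abs_le]; constructor <;> linarith [(ha x).1, (ha x).2]
        · exact (integrable_const _).indicator (MeasurableSet.univ.diff hK.measurableSet)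
        · by_cases hx : x ∈ K
          · simp [hx, ha1 (Or.inl hx)]
          · simp [hx, (ha x).1]
    _ = m.real (Set.univ \ K) := by
        rw [integral_indicator_const _ (MeasurableSet.univ.diff hK.measurableSet)]; simp
    _ ≤ ε := ENNReal.toReal_le_of_le_ofReal hε.le hKm.le

/-- Integrals of bounded continuous functions depend continuously on a parameter. -/
theorem continuous_param (m : Measure X) [IsFiniteMeasure m] [m.Regular] {Y : Type*}
    [TopologicalSpace Y] {E : Type*} [NormedAddCommGroup E] [NormedSpace ℝ E]
    [SecondCountableTopology E] {H : Y → X → E} (hH : Continuous fun p : Y × X => H p.1 p.2) {C : ℝ}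
    (hC : ∀ y x, ‖H y x‖ ≤ C) : Continuous fun y => ∫ x, H y x ∂m := by
  refine continuous_of_uniform_approx_of_continuous fun u hu => ?_
  obtain ⟨ε, hε, hεu⟩ := Metric.mem_uniformity_dist.1 hu
  have hC0 : 0 ≤ |C| + 1 := by positivity
  obtain ⟨a, hac, ha, -, hai⟩ := exists_cutoff m isCompact_empty
    (ε := ε / 2 / (|C| + 1)) (by positivity)
  have h1 : ∀ y, Integrable (fun x => H y x) m := fun y =>
    integrable_of_bdd (hH.comp (Continuous.prodMk_right y)) (hC y)
  have h2 : ∀ y, Integrable (fun x => a x • H y x) m := fun y =>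
    integrable_of_bdd (C := C) (a.continuous.smul
      (hH.comp (Continuous.prodMk_right y))) fun x => by
        rw [norm_smul, Real.norm_of_nonneg (ha x).1]
        exact (mul_le_of_le_one_left (norm_nonneg _) (ha x).2).trans (hC y x)
  refine ⟨fun y => ∫ x, a x • H y x ∂m, ?_, fun y => hεu ?_⟩
  · rw [← continuousOn_univ]
    refine continuousOn_integral_of_compact_support hac.isCompact ?_ ?_
    · refine Continuous.continuousOn ?_
      exact (a.continuous.comp continuous_snd).smul hH
    · intro p x _ hx
      simp [image_eq_zero_of_notMem_tsupport hx]
  · rw [dist_eq_norm, ← integral_sub (h1 y) (h2 y)]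
    calc ‖∫ x, (H y x - a x • H y x) ∂m‖ ≤ ∫ x, (1 - a x) * (|C| + 1) ∂m := by
          refine norm_integral_le_of_norm_le ?_ (Eventually.of_forall fun x => ?_)
          · refine Integrable.mul_const ?_ _
            exact integrable_of_bdd (C := 1) (by fun_prop) fun x => by
              rw [Real.norm_eq_abs, abs_le]; constructor <;> linarith [(ha x).1, (ha x).2]
          · have : H y x - a x • H y x = (1 - a x) • H y x := by
              rw [sub_smul, one_smul]
            rw [this, norm_smul, Real.norm_of_nonneg (by linarith [(ha x).2])]
            exact mul_le_mul_of_nonneg_left (by linarith [hC y x, le_abs_self C])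
              (by linarith [(ha x).2])
      _ = (∫ x, (1 - a x) ∂m) * (|C| + 1) := integral_mul_const _ _
      _ ≤ ε / 2 / (|C| + 1) * (|C| + 1) := mul_le_mul_of_nonneg_right hai hC0
      _ = ε / 2 := by field_simp
      _ < ε := by linarith


section Fubini

variable {Y : Type*} [MeasurableSpace Y] [TopologicalSpace Y] [BorelSpace Y] [T2Space Y]
  [LocallyCompactSpace Y]

theorem fubini_estimate (m : Measure X) (n : Measure Y) [IsFiniteMeasure m] [m.Regular]
    [IsFiniteMeasure n] [n.Regular] {H : X → Y → ℂ}
    (hH : Continuous fun p : X × Y => H p.1 p.2) {C : ℝ} (hC : ∀ x y, ‖H x y‖ ≤ C)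
    {a : C(X, ℝ)} {b : C(Y, ℝ)} (ha : ∀ x, 0 ≤ a x ∧ a x ≤ 1)
    (hb : ∀ y, 0 ≤ b y ∧ b y ≤ 1) :
    ‖∫ x, ∫ y, H x y ∂n ∂m - ∫ x, ∫ y, (a x * b y) • H x y ∂n ∂m‖ ≤
      C * ((∫ x, (1 - a x) ∂m) * n.real Set.univ + m.real Set.univ * ∫ y, (1 - b y) ∂n) := by
  have ia : Integrable (fun x => 1 - a x) m := integrable_of_bdd (C := 1) (by fun_prop) fun x => by
    rw [Real.norm_eq_abs, abs_le]; constructor <;> linarith [(ha x).1, (ha x).2]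
  have ib : Integrable (fun y => 1 - b y) n := integrable_of_bdd (C := 1) (by fun_prop) fun x => by
    rw [Real.norm_eq_abs, abs_le]; constructor <;> linarith [(hb x).1, (hb x).2]
  have hH' : Continuous fun p : X × Y => (a p.1 * b p.2) • H p.1 p.2 := by fun_prop
  have hC' : ∀ x y, ‖(a x * b y) • H x y‖ ≤ C := fun x y => by
    rw [norm_smul, Real.norm_of_nonneg (mul_nonneg (ha x).1 (hb y).1)]
    exact (mul_le_of_le_one_left (norm_nonneg _)
      (mul_le_one₀ (ha x).2 (hb y).1 (hb y).2)).trans (hC x y)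
  have key : ∀ G : X → Y → ℂ, Continuous (fun p : X × Y => G p.1 p.2) → (∀ x y, ‖G x y‖ ≤ C) →
      Integrable (fun x => ∫ y, G x y ∂n) m := fun G hG hGC =>
    integrable_of_bdd (continuous_param n hG hGC) (C := C * n.real Set.univ) fun x =>
      norm_integral_le_of_norm_le_const (Eventually.of_forall (hGC x))
  have key2 : ∀ G : X → Y → ℂ, Continuous (fun p : X × Y => G p.1 p.2) → (∀ x y, ‖G x y‖ ≤ C) →
      ∀ x, Integrable (fun y => G x y) n := fun G hG hGC x =>
    integrable_of_bdd (hG.comp (Continuous.prodMk_right x)) (hGC x)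
  rw [← integral_sub (key _ hH hC) (key _ hH' hC')]
  have e : ∀ x, ∫ y, H x y ∂n - ∫ y, (a x * b y) • H x y ∂n =
      ∫ y, (H x y - (a x * b y) • H x y) ∂n := fun x =>
    (integral_sub (key2 _ hH hC x) (key2 _ hH' hC' x)).symm
  have inner : ∀ x, ‖∫ y, H x y ∂n - ∫ y, (a x * b y) • H x y ∂n‖ ≤
      C * ((1 - a x) * n.real Set.univ + ∫ y, (1 - b y) ∂n) := by
    intro x
    rw [e x]
    have hint : Integrable (fun y => C * ((1 - a x) + (1 - b y))) n :=
      ((integrable_const _).add ib).const_mul _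
    refine (norm_integral_le_of_norm_le hint (Eventually.of_forall fun y => ?_)).trans_eq ?_
    · have : H x y - (a x * b y) • H x y = (1 - a x * b y) • H x y := by
        rw [sub_smul, one_smul]
      rw [this, norm_smul, Real.norm_of_nonneg
        (by linarith [mul_le_one₀ (ha x).2 (hb y).1 (hb y).2]), mul_comm C]
      refine mul_le_mul ?_ (hC x y) (norm_nonneg _) (by linarith [(ha x).2, (hb y).2])
      nlinarith [(ha x).1, (ha x).2, (hb y).1, (hb y).2]
    · rw [integral_const_mul, integral_add (integrable_const _) ib, integral_const]
      simp [mul_comm]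
  have hint : Integrable (fun x => C * ((1 - a x) * n.real Set.univ + ∫ y, (1 - b y) ∂n)) m :=
    ((ia.mul_const _).add (integrable_const _)).const_mul _
  refine (norm_integral_le_of_norm_le hint (Eventually.of_forall inner)).trans_eq ?_
  rw [integral_const_mul, integral_add (ia.mul_const _) (integrable_const _), integral_mul_const,
    integral_const]
  simp

/-- Fubini for bounded continuous functions and finite regular measures. -/
theorem fubini (m : Measure X) (n : Measure Y) [IsFiniteMeasure m] [m.Regular]
    [IsFiniteMeasure n] [n.Regular] {H : X → Y → ℂ}
    (hH : Continuous fun p : X × Y => H p.1 p.2) {C : ℝ} (hC : ∀ x y, ‖H x y‖ ≤ C) :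
    ∫ x, ∫ y, H x y ∂n ∂m = ∫ y, ∫ x, H x y ∂m ∂n := by
  have hC1 : ∀ x y, ‖H x y‖ ≤ |C| := fun x y => (hC x y).trans (le_abs_self C)
  have hs : Continuous fun p : Y × X => H p.2 p.1 := hH.comp continuous_swap
  rw [← sub_eq_zero, ← norm_le_zero_iff]
  refine le_of_forall_pos_le_add fun ε hε => ?_
  set D := 2 * (|C| + 1) * (m.real Set.univ + n.real Set.univ + 1) with hD
  have hm : 0 ≤ m.real Set.univ := measureReal_nonneg
  have hn : 0 ≤ n.real Set.univ := measureReal_nonneg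
  have hDpos : 0 < D := by positivity
  obtain ⟨a, hac, ha, -, hai⟩ := exists_cutoff m isCompact_empty (ε := ε / D) (by positivity)
  obtain ⟨b, hbc, hb, -, hbi⟩ := exists_cutoff n isCompact_empty (ε := ε / D) (by positivity)
  have h1 := fubini_estimate m n hH hC1 ha hb
  have h2 := fubini_estimate n m hs (fun y x => hC1 x y) hb ha
  have h3 : ∫ x, ∫ y, (a x * b y) • H x y ∂n ∂m = ∫ y, ∫ x, (b y * a x) • H x y ∂m ∂n := by
    simp only [mul_comm (b _) (a _)]
    refine integral_integral_swap_of_hasCompactSupport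
      (f := fun x y => (a x * b y) • H x y) ?_ ?_
    · change Continuous fun p : X × Y => (a p.1 * b p.2) • H p.1 p.2
      fun_prop
    · refine HasCompactSupport.of_support_subset_isCompact (hac.isCompact.prod hbc.isCompact) ?_
      rintro ⟨x, y⟩ hxy
      simp only [Function.mem_support, Function.uncurry_apply_pair, ne_eq, smul_eq_zero,
        mul_eq_zero, not_or] at hxy
      exact ⟨subset_tsupport _ hxy.1.1, subset_tsupport _ hxy.1.2⟩
  rw [h3] at h1
  rw [norm_sub_rev] at h2
  have h4 := (norm_sub_le_norm_sub_add_norm_sub _ _ _).trans (add_le_add h1 h2)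
  refine h4.trans ?_
  have hC0 := abs_nonneg C
  have e0 : 0 < ε / D := by positivity
  have hq : |C| * ((∫ x, (1 - a x) ∂m) * n.real Set.univ +
      m.real Set.univ * ∫ y, (1 - b y) ∂n) ≤ |C| * ((ε / D) * n.real Set.univ
        + m.real Set.univ * (ε / D)) := by gcongr
  have hq2 : |C| * ((∫ x, (1 - b x) ∂n) * m.real Set.univ +
      n.real Set.univ * ∫ y, (1 - a y) ∂m) ≤ |C| * ((ε / D) * m.real Set.univ
        + n.real Set.univ * (ε / D)) := by gcongr
  have hfin : 2 * (|C| * ((ε / D) * (m.real Set.univ + n.real Set.univ))) ≤ ε := by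
    have h5 : D * (ε / D) = ε := by field_simp
    calc 2 * (|C| * ((ε / D) * (m.real Set.univ + n.real Set.univ)))
        = 2 * |C| * (m.real Set.univ + n.real Set.univ) * (ε / D) := by ring
      _ ≤ 2 * (|C| + 1) * (m.real Set.univ + n.real Set.univ + 1) * (ε / D) := by
          refine mul_le_mul_of_nonneg_right ?_ e0.le
          nlinarith
      _ = ε := h5
  linarith

end Fubini

end Radon

section Conv

variable {S : Type*} [Mul S] [TopologicalSpace S] [ContinuousMul S] [T2Space S]
  [LocallyCompactSpace S] [MeasurableSpace S] [BorelSpace S]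

theorem continuous_conv_inner (m : Measure S) [IsFiniteMeasure m] [m.Regular] {E : Type*}
    [NormedAddCommGroup E] [NormedSpace ℝ E] [SecondCountableTopology E] {f : S → E}
    (hf : Continuous f) {C : ℝ} (hC : ∀ x, ‖f x‖ ≤ C) :
    Continuous fun y => ∫ x, f (x * y) ∂m :=
  continuous_param m (H := fun y x => f (x * y))
    (hf.comp (continuous_snd.mul continuous_fst)) fun _ _ => hC _

theorem integrable_conv_inner (m n : Measure S) [IsFiniteMeasure m] [m.Regular]
    [IsFiniteMeasure n] {E : Type*}
    [NormedAddCommGroup E] [NormedSpace ℝ E] [SecondCountableTopology E] {f : S → E}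
    (hf : Continuous f) {C : ℝ} (hC : ∀ x, ‖f x‖ ≤ C) :
    Integrable (fun y => ∫ x, f (x * y) ∂m) n :=
  integrable_of_bdd (continuous_conv_inner m hf hC) (C := C * m.real Set.univ) fun _ =>
      norm_integral_le_of_norm_le_const (Eventually.of_forall fun _ => hC _)

theorem integrable_trans (m : Measure S) [IsFiniteMeasure m] {E : Type*}
    [NormedAddCommGroup E] [SecondCountableTopology E] {f : S → E}
    (hf : Continuous f) {C : ℝ} (hC : ∀ x, ‖f x‖ ≤ C) (y : S) :
    Integrable (fun x => f (x * y)) m :=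
  integrable_of_bdd (hf.comp (continuous_mul_const y)) fun _ => hC _

theorem exists_bound_cc (f : C_c(S, ℝ)) : ∃ C, ∀ x, ‖f x‖ ≤ C :=
  f.hasCompactSupport.exists_bound_of_continuous f.continuous

/-- The positive functional `f ↦ ∫∫ f(xy) dm(x) dn(y)`. -/
def convFunctional (m n : Measure S) [IsFiniteMeasure m] [m.Regular] [IsFiniteMeasure n] :
    C_c(S, ℝ) →ₚ[ℝ] ℝ :=
  PositiveLinearMap.mk₀
    { toFun := fun f => ∫ y, ∫ x, f (x * y) ∂m ∂n
      map_add' := fun f g => by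
        obtain ⟨C, hC⟩ := exists_bound_cc f
        obtain ⟨D, hD⟩ := exists_bound_cc g
        refine Eq.trans ?_ (integral_add (integrable_conv_inner m n f.continuous hC)
          (integrable_conv_inner m n g.continuous hD))
        congr 1 with y
        exact integral_add (integrable_trans m f.continuous hC y)
          (integrable_trans m g.continuous hD y)
      map_smul' := fun c f => by
        simp [integral_const_mul] }
    fun f hf => integral_nonneg fun y => integral_nonneg fun x => hf (x * y)

theorem exists_conv_pos (m n : Measure S) [IsFiniteMeasure m] [m.Regular] [IsFiniteMeasure n]
    [n.Regular] : ∃ k : Measure S, IsFiniteMeasure k ∧ k.Regular ∧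
      k Set.univ ≤ m Set.univ * n Set.univ ∧
      ∀ (f : S → ℂ), Continuous f → (∃ C, ∀ x, ‖f x‖ ≤ C) →
        ∫ z, f z ∂k = ∫ y, ∫ x, f (x * y) ∂m ∂n := by
  set k := RealRMK.rieszMeasure (convFunctional m n) with hk
  have hreg : k.Regular := inferInstance
  have hint : ∀ f : C_c(S, ℝ), ∫ z, f z ∂k = ∫ y, ∫ x, f (x * y) ∂m ∂n := fun f =>
    RealRMK.integral_rieszMeasure (convFunctional m n) f
  have hbound : k Set.univ ≤ m Set.univ * n Set.univ := by
    rw [isOpen_univ.measure_eq_iSup_isCompact]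
    refine iSup₂_le fun K _ => iSup_le fun hK => ?_
    obtain ⟨a, ha1, -, hac, ha⟩ := exists_continuous_one_zero_of_isCompact hK
      (isClosed_empty) (Set.disjoint_empty _)
    let f : C_c(S, ℝ) := ⟨a, hac⟩
    have h1 : k K ≤ ENNReal.ofReal (∫ z, f z ∂k) := by
      rw [ofReal_integral_eq_lintegral_ofReal f.integrable
        (Eventually.of_forall fun x => (ha x).1)]
      rw [← lintegral_indicator_one hK.measurableSet]
      refine lintegral_mono fun x => ?_
      by_cases hx : x ∈ K
      · simp [hx, f, ha1 hx]
      · simp [hx]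
    refine h1.trans ?_
    rw [hint f]
    have h2 : ∫ y, ∫ x, f (x * y) ∂m ∂n ≤ m.real Set.univ * n.real Set.univ := by
      refine (le_abs_self _).trans ?_
      rw [← Real.norm_eq_abs]
      refine norm_integral_le_of_norm_le_const (Eventually.of_forall fun y => ?_)
      rw [← one_mul (m.real Set.univ)]
      refine norm_integral_le_of_norm_le_const (Eventually.of_forall fun x => ?_)
      exact (Real.norm_of_nonneg (ha (x * y)).1).trans_le (ha (x * y)).2
    refine (ENNReal.ofReal_le_ofReal h2).trans_eq ?_
    rw [ENNReal.ofReal_mul measureReal_nonneg, ofReal_measureReal, ofReal_measureReal]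
  have hfin : IsFiniteMeasure k :=
    ⟨hbound.trans_lt (ENNReal.mul_lt_top (measure_lt_top _ _) (measure_lt_top _ _))⟩
  refine ⟨k, hfin, hreg, hbound, ?_⟩
  -- real bounded functions
  have hreal : ∀ (f : S → ℝ), Continuous f → (∃ C, ∀ x, ‖f x‖ ≤ C) →
        ∫ z, f z ∂k = ∫ y, ∫ x, f (x * y) ∂m ∂n := by
    rintro f hf ⟨C, hC⟩
    rw [← sub_eq_zero, ← norm_le_zero_iff]
    refine le_of_forall_pos_le_add fun ε hε => ?_
    set D := (|C| + 1) * (m.real Set.univ + n.real Set.univ + 1) with hD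
    have hm : 0 ≤ m.real Set.univ := measureReal_nonneg
    have hn : 0 ≤ n.real Set.univ := measureReal_nonneg
    have hC0 := abs_nonneg C
    have hDpos : 0 < D := by positivity
    have e0 : 0 < ε / D := by positivity
    obtain ⟨b, hbc, hb, -, hbi⟩ := exists_cutoff m isCompact_empty e0
    obtain ⟨c, hcc, hc, -, hci⟩ := exists_cutoff n isCompact_empty e0
    obtain ⟨a, hac, ha, ha1, hai⟩ := exists_cutoff k
      ((hbc.isCompact.prod hcc.isCompact).image continuous_mul) e0
    have unit : ∀ (g : C(S, ℝ)), (∀ x, 0 ≤ g x ∧ g x ≤ 1) → ∀ x, ‖1 - g x‖ ≤ 1 := fun g hg x => by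
      rw [Real.norm_eq_abs, abs_le]; constructor <;> linarith [(hg x).1, (hg x).2]
    have ib : Integrable (fun x => 1 - b x) m :=
      integrable_of_bdd (C := 1) (by fun_prop) (unit b hb)
    have ic : Integrable (fun x => 1 - c x) n :=
      integrable_of_bdd (C := 1) (by fun_prop) (unit c hc)
    have ia : Integrable (fun x => 1 - a x) k :=
      integrable_of_bdd (C := 1) (by fun_prop) (unit a ha)
    let af : C_c(S, ℝ) := ⟨⟨fun x => a x * f x, a.continuous.mul hf⟩, hac.mul_right⟩
    have hafc : Continuous fun x => af x := a.continuous.mul hf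
    have haf : ∀ x, af x = a x * f x := fun _ => rfl
    have hafC : ∀ x, ‖af x‖ ≤ C := fun x => by
      rw [haf, norm_mul, Real.norm_of_nonneg (ha x).1]
      exact (mul_le_of_le_one_left (norm_nonneg _) (ha x).2).trans (hC x)
    have hdiff : ∀ x, ‖f x - af x‖ ≤ |C| * (1 - a x) := fun x => by
      have : f x - af x = (1 - a x) * f x := by rw [haf]; ring
      rw [this, norm_mul, Real.norm_of_nonneg (by linarith [(ha x).2]), mul_comm]
      exact mul_le_mul_of_nonneg_right ((hC x).trans (le_abs_self C)) (by linarith [(ha x).2])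
    have E1 : ‖∫ z, f z ∂k - ∫ z, af z ∂k‖ ≤ |C| * (ε / D) := by
      rw [← integral_sub (integrable_of_bdd hf hC) (integrable_of_bdd hafc hafC)]
      refine (norm_integral_le_of_norm_le (ia.const_mul |C|)
        (Eventually.of_forall hdiff)).trans ?_
      rw [integral_const_mul]
      exact mul_le_mul_of_nonneg_left hai hC0
    have hprod : ∀ x y, 1 - a (x * y) ≤ (1 - b x) + (1 - c y) := fun x y => by
      by_cases hx : x ∈ tsupport b
      · by_cases hy : y ∈ tsupport c
        · rw [ha1 (x * y) ⟨(x, y), ⟨hx, hy⟩, rfl⟩]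
          linarith [(hb x).2, (hc y).2]
        · rw [image_eq_zero_of_notMem_tsupport hy]
          linarith [(hb x).2, (ha (x * y)).1]
      · rw [image_eq_zero_of_notMem_tsupport hx]
        linarith [(hc y).2, (ha (x * y)).1]
    have E2 : ‖∫ y, ∫ x, f (x * y) ∂m ∂n - ∫ y, ∫ x, af (x * y) ∂m ∂n‖ ≤
        |C| * ((ε / D) * n.real Set.univ + m.real Set.univ * (ε / D)) := by
      rw [← integral_sub (integrable_conv_inner m n hf hC)
        (integrable_conv_inner m n hafc hafC)]
      have inner : ∀ y, ‖∫ x, f (x * y) ∂m - ∫ x, af (x * y) ∂m‖ ≤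
          |C| * (ε / D + m.real Set.univ * (1 - c y)) := fun y => by
        have h3 := integral_sub (integrable_trans m hf hC y)
          (integrable_trans m hafc hafC y)
        refine (congrArg norm h3.symm).trans_le ?_
        refine (norm_integral_le_of_norm_le ((ib.add (integrable_const (1 - c y))).const_mul |C|)
          (Eventually.of_forall fun x => (hdiff (x * y)).trans
            (mul_le_mul_of_nonneg_left (hprod x y) hC0))).trans ?_
        rw [integral_const_mul]
        refine mul_le_mul_of_nonneg_left ?_ hC0
        refine (integral_add ib (integrable_const (1 - c y))).trans_le ?_
        rw [integral_const, smul_eq_mul]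
        linarith
      refine (norm_integral_le_of_norm_le
        (((integrable_const (ε / D)).add (ic.const_mul (m.real Set.univ))).const_mul |C|)
        (Eventually.of_forall inner)).trans ?_
      rw [integral_const_mul]
      refine mul_le_mul_of_nonneg_left ?_ hC0
      refine (integral_add (integrable_const (ε / D)) (ic.const_mul _)).trans_le ?_
      rw [integral_const, smul_eq_mul, integral_const_mul, mul_comm]
      gcongr
    rw [hint af] at E1
    rw [norm_sub_rev] at E2
    refine (norm_sub_le_norm_sub_add_norm_sub _ _ _).trans ((add_le_add E1 E2).trans ?_)
    have h5 : D * (ε / D) = ε := by field_simp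
    calc |C| * (ε / D) + |C| * (ε / D * n.real Set.univ + m.real Set.univ * (ε / D))
        = |C| * (m.real Set.univ + n.real Set.univ + 1) * (ε / D) := by ring
      _ ≤ (|C| + 1) * (m.real Set.univ + n.real Set.univ + 1) * (ε / D) := by
          refine mul_le_mul_of_nonneg_right ?_ e0.le
          nlinarith
      _ = 0 + ε := by rw [zero_add]; exact h5
  rintro f hf ⟨C, hC⟩
  have h1 := hreal (fun z => (f z).re) (Complex.continuous_re.comp hf)
    ⟨C, fun x => (Complex.abs_re_le_norm _).trans (hC x)⟩
  have h2 := hreal (fun z => (f z).im) (Complex.continuous_im.comp hf)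
    ⟨C, fun x => (Complex.abs_im_le_norm _).trans (hC x)⟩
  have e : ∀ y, Integrable (fun x => f (x * y)) m := integrable_trans m hf hC
  apply Complex.ext
  · have := integral_re (𝕜 := ℂ) (integrable_of_bdd (m := k) hf hC)
    have h3 := integral_re (𝕜 := ℂ) (integrable_conv_inner m n hf hC)
    simp only [RCLike.re_eq_complex_re] at this h3
    rw [← this, h1, ← h3]
    congr 1 with y
    have := integral_re (𝕜 := ℂ) (e y)
    simpa using this
  · have := integral_im (𝕜 := ℂ) (integrable_of_bdd (m := k) hf hC)
    have h3 := integral_im (𝕜 := ℂ) (integrable_conv_inner m n hf hC)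
    simp only [RCLike.im_eq_complex_im] at this h3
    rw [← this, h2, ← h3]
    congr 1 with y
    have := integral_im (𝕜 := ℂ) (e y)
    simpa using this

end Conv

section MS

variable {S : Type*} [TopologicalSpace S] [T2Space S] [MeasurableSpace S] [BorelSpace S]

variable (S) in
/-- The space of complex Borel measures with regular total variation. Complex measures have
automatically finite total variation. -/
def regularMeasures : Submodule ℂ (ComplexMeasure S) where
  carrier := {μ | μ.variation.Regular}
  zero_mem' := by
    change (VectorMeasure.variation (0 : ComplexMeasure S)).Regular
    rw [VectorMeasure.variation_zero]; infer_instance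
  add_mem' := by
    intro μ ν hμ hν
    have h1 : μ.variation.Regular := hμ
    have h2 : ν.variation.Regular := hν
    have := regular_add (m := μ.variation) (n := ν.variation)
    exact regular_of_le VectorMeasure.variation_add_le
  smul_mem' := by
    intro c μ hμ
    have h1 : μ.variation.Regular := hμ
    change (c • μ).variation.Regular
    rw [VectorMeasure.variation_smul]; infer_instance

variable (S) in
/-- `M(S)`: the bounded regular complex Borel measures on `S`. -/
def M : Type _ := regularMeasures S

instance : AddCommGroup (M S) := inferInstanceAs (AddCommGroup (regularMeasures S))
instance : Module ℂ (M S) := inferInstanceAs (Module ℂ (regularMeasures S))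

/-- The total variation measure `|μ|`. -/
def M.var (μ : M S) : Measure S := μ.1.variation

instance (μ : M S) : IsFiniteMeasure μ.var := finite_variation μ.1
instance (μ : M S) : μ.var.Regular := μ.2

/-- The integral `∫ f dμ`. -/
def M.int (μ : M S) (f : S → ℂ) : ℂ := cint μ.1 f

/-- A positive finite regular measure as an element of `M(S)`. -/
def ofM (n : Measure S) [IsFiniteMeasure n] [h : n.Regular] : M S :=
  ⟨toC n, by change (toC n).variation.Regular; rwa [variation_toC]⟩

theorem var_ofM (n : Measure S) [IsFiniteMeasure n] [n.Regular] : (ofM n).var = n :=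
  variation_toC n

theorem var_add_le (μ ν : M S) : (μ + ν).var ≤ μ.var + ν.var := VectorMeasure.variation_add_le

theorem var_smul (c : ℂ) (μ : M S) : (c • μ).var = ‖c‖₊ • μ.var := VectorMeasure.variation_smul

/-- The total variation norm `‖μ‖ = ∫ d|μ|`. -/
instance : Norm (M S) := ⟨fun μ => μ.var.real Set.univ⟩

theorem norm_def (μ : M S) : ‖μ‖ = μ.var.real Set.univ := rfl

theorem M.core : NormedSpace.Core ℂ (M S) where
  norm_nonneg _ := measureReal_nonneg
  norm_smul c μ := by
    rw [norm_def, norm_def, var_smul, measureReal_def, measureReal_def, Measure.smul_apply,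
      ENNReal.smul_def, smul_eq_mul, ENNReal.toReal_mul]
    simp
  norm_triangle μ ν := by
    rw [norm_def, norm_def, norm_def, ← measureReal_add_apply]
    exact ENNReal.toReal_mono (measure_ne_top _ _) (var_add_le μ ν _)
  norm_eq_zero_iff μ := by
    constructor
    · intro h
      have h0 : μ.var Set.univ = 0 := by
        rw [norm_def, measureReal_def] at h
        exact (ENNReal.toReal_eq_zero_iff _).1 h |>.resolve_right (measure_ne_top _ _)
      refine Subtype.ext (VectorMeasure.ext fun A hA => ?_)
      exact (VectorMeasure.variation_apply_eq_zero MeasurableSet.univ).1 h0 A (Set.subset_univ _) hA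
    · rintro rfl
      rw [norm_def, measureReal_def]
      have : (0 : M S).var = 0 := VectorMeasure.variation_zero
      simp [this]

instance : NormedAddCommGroup (M S) := NormedAddCommGroup.ofCore M.core
instance : NormedSpace ℂ (M S) := NormedSpace.ofCore M.core

theorem exists_decomp_M (μ : M S) :
    ∃ m : Fin 4 → Measure S, ∃ _ : ∀ i, IsFiniteMeasure (m i), ∃ _ : ∀ i, (m i).Regular,
      (∀ i, m i ≤ μ.var) ∧
      μ = ofM (m 0) - ofM (m 1) + Complex.I • (ofM (m 2) - ofM (m 3)) := by
  obtain ⟨m, hf, hle, he⟩ := exists_decomp μ.1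
  exact ⟨m, hf, fun i => regular_of_le (m := μ.var) (hle i), hle, Subtype.ext he⟩

theorem M.ind {P : M S → Prop}
    (pos : ∀ (n : Measure S) [IsFiniteMeasure n] [n.Regular], P (ofM n))
    (add : ∀ μ ν, P μ → P ν → P (μ + ν)) (smul : ∀ (c : ℂ) μ, P μ → P (c • μ)) (μ : M S) :
    P μ := by
  obtain ⟨m, hf, hr, hle, he⟩ := exists_decomp_M μ
  rw [he]
  have hsub : ∀ μ ν, P μ → P ν → P (μ - ν) := fun μ ν h1 h2 => by
    rw [sub_eq_add_neg, ← neg_one_smul ℂ ν]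
    exact add _ _ h1 (smul _ _ h2)
  exact add _ _ (hsub _ _ (pos _) (pos _)) (smul _ _ (hsub _ _ (pos _) (pos _)))

theorem integrable_M (μ : M S) {f : S → ℂ} (hf : Continuous f) {C : ℝ} (hC : ∀ x, ‖f x‖ ≤ C) :
    Integrable f μ.1.variation := integrable_of_bdd hf hC

theorem int_ofM (n : Measure S) [IsFiniteMeasure n] [n.Regular] (f : S → ℂ) :
    (ofM n).int f = ∫ x, f x ∂n := cint_toC n f

theorem int_add (μ ν : M S) {f : S → ℂ} (hf : Continuous f) {C : ℝ} (hC : ∀ x, ‖f x‖ ≤ C) :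
    (μ + ν).int f = μ.int f + ν.int f :=
  cint_add μ.1 ν.1 (integrable_M μ hf hC) (integrable_M ν hf hC)

theorem int_smul (c : ℂ) (μ : M S) {f : S → ℂ} (hf : Continuous f) {C : ℝ}
    (hC : ∀ x, ‖f x‖ ≤ C) : (c • μ).int f = c * μ.int f :=
  cint_smul c μ.1 (integrable_M μ hf hC)

theorem int_sub (μ ν : M S) {f : S → ℂ} (hf : Continuous f) {C : ℝ} (hC : ∀ x, ‖f x‖ ≤ C) :
    (μ - ν).int f = μ.int f - ν.int f := by
  rw [sub_eq_add_neg, ← neg_one_smul ℂ ν, int_add _ _ hf hC, int_smul _ _ hf hC]; ring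

theorem int_fun_add (μ : M S) {f g : S → ℂ} (hf : Continuous f) {C : ℝ} (hC : ∀ x, ‖f x‖ ≤ C)
    (hg : Continuous g) {D : ℝ} (hD : ∀ x, ‖g x‖ ≤ D) :
    μ.int (fun x => f x + g x) = μ.int f + μ.int g :=
  VectorMeasure.integral_fun_add (integrable_M μ hf hC) (integrable_M μ hg hD)

theorem int_fun_smul (μ : M S) (c : ℂ) {f : S → ℂ} (hf : Continuous f) {C : ℝ}
    (hC : ∀ x, ‖f x‖ ≤ C) : μ.int (fun x => c * f x) = c * μ.int f := by
  have hcf : Continuous fun x => c * f x := continuous_const.mul hf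
  have hcC : ∀ x, ‖c * f x‖ ≤ ‖c‖ * C := fun x => by
    rw [norm_mul]; exact mul_le_mul_of_nonneg_left (hC x) (norm_nonneg _)
  induction μ using M.ind with
  | pos n => rw [int_ofM, int_ofM, integral_const_mul]
  | add μ ν h1 h2 => rw [int_add _ _ hcf hcC, int_add _ _ hf hC, h1, h2, mul_add]
  | smul d μ h => rw [int_smul _ _ hcf hcC, int_smul _ _ hf hC, h]; ring

theorem norm_int_le (μ : M S) {f : S → ℂ} {C : ℝ} (hC : ∀ x, ‖f x‖ ≤ C) :
    ‖μ.int f‖ ≤ C * ‖μ‖ := by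
  have h := VectorMeasure.norm_integral_le_of_norm_le_const (μ := μ.1)
    (B := ContinuousLinearMap.mul ℝ ℂ) (Eventually.of_forall hC)
  rwa [ContinuousLinearMap.opNorm_mul, mul_one] at h

variable [LocallyCompactSpace S]

/-- A regular measure is determined by its integrals of compactly supported functions. -/
theorem M.ext_of_int {μ ν : M S} (h : ∀ f : C_c(S, ℝ), μ.int (fun x => f x) = ν.int fun x => f x) :
    μ = ν := by
  rw [← sub_eq_zero]
  have h0 : ∀ f : C_c(S, ℝ), (μ - ν).int (fun x => f x) = 0 := fun f => by
    obtain ⟨C, hC⟩ := f.hasCompactSupport.exists_bound_of_continuous f.continuous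
    rw [int_sub μ ν (f := fun x => (f x : ℂ)) (Complex.continuous_ofReal.comp f.continuous)
      (C := C) (fun x => by rw [Complex.norm_real]; exact hC x), h f, sub_self]
  generalize μ - ν = κ at h0
  obtain ⟨m, hf, hr, hle, he⟩ := exists_decomp_M κ
  have key : ∀ f : C_c(S, ℝ), ∫ x, f x ∂(m 0) = ∫ x, f x ∂(m 1) ∧
      ∫ x, f x ∂(m 2) = ∫ x, f x ∂(m 3) := fun f => by
    obtain ⟨C, hC⟩ := f.hasCompactSupport.exists_bound_of_continuous f.continuous
    have hfc : Continuous fun x => (f x : ℂ) := Complex.continuous_ofReal.comp f.continuous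
    have hfC : ∀ x, ‖(f x : ℂ)‖ ≤ C := fun x => by rw [Complex.norm_real]; exact hC x
    have h1 := h0 f
    rw [he, int_add _ _ hfc hfC, int_smul _ _ hfc hfC, int_sub _ _ hfc hfC, int_sub _ _ hfc hfC]
      at h1
    simp only [int_ofM, integral_complex_ofReal] at h1
    have hre := congrArg Complex.re h1
    have him := congrArg Complex.im h1
    simp at hre him
    exact ⟨by linarith, by linarith⟩
  have e1 : m 0 = m 1 := Measure.ext_of_integral_eq_on_compactlySupported fun f => (key f).1
  have e2 : m 2 = m 3 := Measure.ext_of_integral_eq_on_compactlySupported fun f => (key f).2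
  rw [he]
  simp only [e1, e2, sub_self, smul_zero, add_zero]

theorem int_param {Y : Type*} [TopologicalSpace Y] (μ : M S) {H : Y → S → ℂ}
    (hH : Continuous fun p : Y × S => H p.1 p.2) {C : ℝ} (hC : ∀ y x, ‖H y x‖ ≤ C) :
    Continuous fun y => μ.int (H y) := by
  have hy : ∀ y, Continuous (H y) := fun y => hH.comp (Continuous.prodMk_right y)
  induction μ using M.ind with
  | pos n => simpa only [int_ofM] using continuous_param n hH hC
  | add μ ν h1 h2 =>
    simp only [int_add _ _ (hy _) (hC _)]
    exact h1.add h2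
  | smul d μ h =>
    simp only [int_smul _ _ (hy _) (hC _)]
    exact continuous_const.mul h

theorem int_fubini (μ ν : M S) {H : S → S → ℂ}
    (hH : Continuous fun p : S × S => H p.1 p.2) {C : ℝ} (hC : ∀ y x, ‖H y x‖ ≤ C) :
    μ.int (fun x => ν.int fun y => H x y) = ν.int fun y => μ.int fun x => H x y := by
  have hl : ∀ x, Continuous (fun y => H x y) := fun y => hH.comp (Continuous.prodMk_right y)
  have hr : ∀ y, Continuous (fun x => H x y) := fun y => hH.comp (Continuous.prodMk_left y)
  have hs : Continuous fun p : S × S => H p.2 p.1 := hH.comp continuous_swap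
  have cl : ∀ ν : M S, Continuous fun x => ν.int fun y => H x y := fun ν => int_param ν hH hC
  have cr : ∀ μ : M S, Continuous fun y => μ.int fun x => H x y := fun μ =>
    int_param μ hs fun y x => hC x y
  have bl : ∀ ν : M S, ∀ x, ‖ν.int fun y => H x y‖ ≤ C * ‖ν‖ := fun ν x => norm_int_le ν (hC x)
  have br : ∀ μ : M S, ∀ y, ‖μ.int fun x => H x y‖ ≤ C * ‖μ‖ := fun μ y =>
    norm_int_le μ fun x => hC x y
  induction μ using M.ind with
  | pos m =>
    induction ν using M.ind with
    | pos n => simpa only [int_ofM] using fubini m n hH hC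
    | add ν₁ ν₂ h1 h2 =>
      simp only [int_add ν₁ ν₂ (hl _) (hC _)]
      rw [int_fun_add _ (cl _) (bl _) (cl _) (bl _), h1, h2, int_add _ _ (cr _) (br _)]
    | smul d ν h =>
      simp only [int_smul d ν (hl _) (hC _)]
      rw [int_fun_smul _ _ (cl _) (bl _), h, int_smul _ _ (cr _) (br _)]
  | add μ₁ μ₂ h1 h2 =>
    simp only [int_add μ₁ μ₂ (hr _) (fun x => hC x _)]
    rw [int_fun_add _ (cr _) (br _) (cr _) (br _), ← h1, ← h2, int_add _ _ (cl _) (bl _)]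
  | smul d μ h =>
    simp only [int_smul d μ (hr _) (fun x => hC x _)]
    rw [int_fun_smul _ _ (cr _) (br _), ← h, int_smul _ _ (cl _) (bl _)]

end MS

section Algebra

variable {S : Type*} [TopologicalSpace S] [T2Space S] [MeasurableSpace S] [BorelSpace S]
  [LocallyCompactSpace S]

section MulOnly
variable [Mul S] [ContinuousMul S]

theorem continuous_inner (μ : M S) {f : S → ℂ} (hf : Continuous f) {C : ℝ}
    (hC : ∀ x, ‖f x‖ ≤ C) : Continuous fun y => μ.int fun x => f (x * y) :=
  int_param μ (H := fun y x => f (x * y)) (hf.comp (continuous_snd.mul continuous_fst))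
    fun _ _ => hC _

theorem bound_inner (μ : M S) {f : S → ℂ} {C : ℝ}
    (hC : ∀ x, ‖f x‖ ≤ C) (y : S) : ‖μ.int fun x => f (x * y)‖ ≤ C * ‖μ‖ :=
  norm_int_le μ fun x => hC (x * y)

theorem exists_conv (μ ν : M S) : ∃ κ : M S, ∀ f : S → ℂ, Continuous f → (∃ C, ∀ x, ‖f x‖ ≤ C) →
    κ.int f = ν.int fun y => μ.int fun x => f (x * y) := by
  induction μ using M.ind with
  | pos m =>
    induction ν using M.ind with
    | pos n =>
      obtain ⟨k, h1, h2, h3, h4⟩ := exists_conv_pos m n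
      refine ⟨ofM k, fun f hf hC => ?_⟩
      simpa only [int_ofM] using h4 f hf hC
    | add ν₁ ν₂ h1 h2 =>
      obtain ⟨κ₁, h1⟩ := h1
      obtain ⟨κ₂, h2⟩ := h2
      refine ⟨κ₁ + κ₂, fun f hf hC => ?_⟩
      obtain ⟨C, hC'⟩ := id hC
      rw [int_add _ _ hf hC', h1 f hf hC, h2 f hf hC,
        int_add _ _ (continuous_inner _ hf hC') (bound_inner _ hC')]
    | smul d ν h =>
      obtain ⟨κ, h⟩ := h
      refine ⟨d • κ, fun f hf hC => ?_⟩
      obtain ⟨C, hC'⟩ := id hC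
      rw [int_smul _ _ hf hC', h f hf hC,
        int_smul _ _ (continuous_inner _ hf hC') (bound_inner _ hC')]
  | add μ₁ μ₂ h1 h2 =>
    obtain ⟨κ₁, h1⟩ := h1
    obtain ⟨κ₂, h2⟩ := h2
    refine ⟨κ₁ + κ₂, fun f hf hC => ?_⟩
    obtain ⟨C, hC'⟩ := id hC
    have hr : ∀ y, Continuous fun x => f (x * y) := fun y => hf.comp (continuous_mul_const y)
    simp only [int_add μ₁ μ₂ (hr _) (fun x => hC' _)]
    rw [int_add _ _ hf hC', h1 f hf hC, h2 f hf hC,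
      int_fun_add _ (continuous_inner _ hf hC') (bound_inner _ hC')
        (continuous_inner _ hf hC') (bound_inner _ hC')]
  | smul d μ h =>
    obtain ⟨κ, h⟩ := h
    refine ⟨d • κ, fun f hf hC => ?_⟩
    obtain ⟨C, hC'⟩ := id hC
    have hr : ∀ y, Continuous fun x => f (x * y) := fun y => hf.comp (continuous_mul_const y)
    simp only [int_smul d μ (hr _) (fun x => hC' _)]
    rw [int_smul _ _ hf hC', h f hf hC,
      int_fun_smul _ _ (continuous_inner _ hf hC') (bound_inner _ hC')]

theorem exists_conv_C0 (μ ν : M S) : ∃ κ : M S, ∀ f : C₀(S, ℂ),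
    κ.int f = ν.int fun y => μ.int fun x => f (x * y) := by
  obtain ⟨κ, h⟩ := exists_conv μ ν
  refine ⟨κ, fun f => h f f.continuous ⟨‖f.toBCF‖, fun x => f.toBCF.norm_coe_le_norm x⟩⟩

/-- Convolution: `μ * ν` is the measure with `∫ f d(μ * ν) = ∫∫ f(xy) dμ(x) dν(y)` for all
`f ∈ C₀(S)`. -/
instance : Mul (M S) := ⟨fun μ ν => Classical.choose (exists_conv_C0 μ ν)⟩

theorem conv_spec_C0 (μ ν : M S) (f : C₀(S, ℂ)) :
    (μ * ν).int f = ν.int fun y => μ.int fun x => f (x * y) :=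
  Classical.choose_spec (exists_conv_C0 μ ν) f

theorem conv_spec (μ ν : M S) {f : S → ℂ} (hf : Continuous f) {C : ℝ} (hC : ∀ x, ‖f x‖ ≤ C) :
    (μ * ν).int f = ν.int fun y => μ.int fun x => f (x * y) := by
  obtain ⟨κ, h⟩ := exists_conv μ ν
  have : μ * ν = κ := by
    refine M.ext_of_int fun g => ?_
    let g' : C₀(S, ℂ) := ⟨⟨fun x => (g x : ℂ), Complex.continuous_ofReal.comp g.continuous⟩, by
      refine HasCompactSupport.is_zero_at_infty ?_
      exact g.hasCompactSupport.comp_left (g := fun r : ℝ => (r : ℂ)) Complex.ofReal_zero⟩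
    have h1 := conv_spec_C0 μ ν g'
    have h2 := h g' g'.continuous ⟨‖g'.toBCF‖, fun x => g'.toBCF.norm_coe_le_norm x⟩
    exact h1.trans h2.symm
  rw [this]
  exact h f hf ⟨C, hC⟩

theorem M.ext_bdd {μ ν : M S} (h : ∀ f : S → ℂ, Continuous f → ∀ C : ℝ, (∀ x, ‖f x‖ ≤ C) →
    μ.int f = ν.int f) : μ = ν := by
  refine M.ext_of_int fun f => ?_
  obtain ⟨C, hC⟩ := f.hasCompactSupport.exists_bound_of_continuous f.continuous
  exact h _ (Complex.continuous_ofReal.comp f.continuous) C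
    fun x => by rw [Complex.norm_real]; exact hC x

theorem M.add_mul' (μ ν κ : M S) : (μ + ν) * κ = μ * κ + ν * κ := by
  refine M.ext_bdd fun f hf C hC => ?_
  have hr : ∀ y, Continuous fun x => f (x * y) := fun y => hf.comp (continuous_mul_const y)
  rw [int_add _ _ hf hC, conv_spec _ _ hf hC, conv_spec _ _ hf hC, conv_spec _ _ hf hC]
  simp only [int_add μ ν (hr _) (fun x => hC _)]
  exact int_fun_add _ (continuous_inner _ hf hC) (bound_inner _ hC)
        (continuous_inner _ hf hC) (bound_inner _ hC)

theorem M.mul_add' (μ ν κ : M S) : μ * (ν + κ) = μ * ν + μ * κ := by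
  refine M.ext_bdd fun f hf C hC => ?_
  rw [int_add _ _ hf hC, conv_spec _ _ hf hC, conv_spec _ _ hf hC, conv_spec _ _ hf hC,
    int_add _ _ (continuous_inner _ hf hC) (bound_inner _ hC)]

theorem M.smul_mul' (c : ℂ) (μ κ : M S) : (c • μ) * κ = c • (μ * κ) := by
  refine M.ext_bdd fun f hf C hC => ?_
  have hr : ∀ y, Continuous fun x => f (x * y) := fun y => hf.comp (continuous_mul_const y)
  rw [int_smul _ _ hf hC, conv_spec _ _ hf hC, conv_spec _ _ hf hC]
  simp only [int_smul c μ (hr _) (fun x => hC _)]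
  exact int_fun_smul _ _ (continuous_inner _ hf hC) (bound_inner _ hC)

theorem M.mul_smul' (c : ℂ) (μ κ : M S) : μ * (c • κ) = c • (μ * κ) := by
  refine M.ext_bdd fun f hf C hC => ?_
  rw [int_smul _ _ hf hC, conv_spec _ _ hf hC, conv_spec _ _ hf hC,
    int_smul _ _ (continuous_inner _ hf hC) (bound_inner _ hC)]

end MulOnly

section Semi
variable [Semigroup S] [ContinuousMul S]

theorem M.mul_assoc' (μ ν κ : M S) : μ * ν * κ = μ * (ν * κ) := by
  refine M.ext_bdd fun f hf C hC => ?_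
  rw [conv_spec _ _ hf hC, conv_spec _ _ hf hC,
    conv_spec _ _ (continuous_inner _ hf hC) (bound_inner _ hC)]
  congr 1 with z
  have hr : Continuous fun x => f (x * z) := hf.comp (continuous_mul_const z)
  rw [conv_spec _ _ hr (fun x => hC _)]
  simp only [mul_assoc]

instance : NonUnitalRing (M S) where
  left_distrib := M.mul_add'
  right_distrib := M.add_mul'
  zero_mul μ := by
    have := M.smul_mul' 0 (0 : M S) μ
    simpa only [zero_smul] using this
  mul_zero μ := by
    have := M.mul_smul' 0 μ (0 : M S)
    simpa only [zero_smul] using this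
  mul_assoc := M.mul_assoc'

instance : IsScalarTower ℂ (M S) (M S) := ⟨fun c μ ν => M.smul_mul' c μ ν⟩
instance : SMulCommClass ℂ (M S) (M S) := ⟨fun c μ ν => (M.mul_smul' c μ ν).symm⟩

end Semi

section Star
variable [InvolutiveStar S] [ContinuousStar S]

/-- The involution `μ*(A) = conj (μ (A*))` on complex measures. -/
def cstar (μ : ComplexMeasure S) : ComplexMeasure S :=
  (μ.map star).mapRange (starRingEnd ℂ : ℂ →+ ℂ) Complex.continuous_conj

theorem measurable_star' : Measurable (star : S → S) := continuous_star.measurable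

theorem cstar_apply (μ : ComplexMeasure S) {A : Set S} (hA : MeasurableSet A) :
    cstar μ A = conj (μ (star ⁻¹' A)) := by
  change conj ((μ.map star) A) = _
  rw [VectorMeasure.map_apply _ measurable_star' hA]

theorem cstar_cstar (μ : ComplexMeasure S) : cstar (cstar μ) = μ := by
  ext A hA
  rw [cstar_apply _ hA, cstar_apply _ (measurable_star' hA), Complex.conj_conj,
    ← Set.preimage_comp]
  have : (star ∘ star : S → S) = id := by ext x; simp
  rw [this, Set.preimage_id]

theorem variation_cstar_le (μ : ComplexMeasure S) :
    (cstar μ).variation ≤ μ.variation.map star := by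
  refine VectorMeasure.variation_le_of_forall_enorm_le fun A hA => ?_
  rw [cstar_apply μ hA, Measure.map_apply measurable_star' hA, ← ofReal_norm, RCLike.norm_conj,
    ofReal_norm]
  exact VectorMeasure.enorm_measure_le_variation _ _

theorem variation_cstar (μ : ComplexMeasure S) :
    (cstar μ).variation = μ.variation.map star := by
  refine le_antisymm (variation_cstar_le μ) ?_
  have h := variation_cstar_le (cstar μ)
  rw [cstar_cstar] at h
  refine (Measure.map_mono h measurable_star').trans_eq ?_
  rw [Measure.map_map measurable_star' measurable_star']
  have : (star ∘ star : S → S) = id := by ext x; simp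
  rw [this, Measure.map_id]

/-- The involution on `M(S)`. -/
instance : Star (M S) := ⟨fun μ => ⟨cstar μ.1, by
  change (cstar μ.1).variation.Regular
  rw [variation_cstar]
  exact regular_map (m := μ.var) continuous_star⟩⟩

theorem var_star (μ : M S) : (star μ).var = μ.var.map star := variation_cstar μ.1

theorem star_ofM (n : Measure S) [IsFiniteMeasure n] [n.Regular] :
    star (ofM n) = @ofM S _ _ _ _ (n.map star) inferInstance (regular_map continuous_star) := by
  refine Subtype.ext (VectorMeasure.ext fun A hA => ?_)
  change cstar (toC n) A = toC (n.map star) A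
  rw [cstar_apply _ hA, toC_apply _ (measurable_star' hA), toC_apply _ hA, Complex.conj_ofReal,
    measureReal_def, measureReal_def, Measure.map_apply measurable_star' hA]

theorem M.star_add' (μ ν : M S) : star (μ + ν) = star μ + star ν := by
  refine Subtype.ext (VectorMeasure.ext fun A hA => ?_)
  change cstar (μ.1 + ν.1) A = cstar μ.1 A + cstar ν.1 A
  rw [cstar_apply _ hA, cstar_apply _ hA, cstar_apply _ hA, ← map_add]
  rfl

theorem M.star_smul' (c : ℂ) (μ : M S) : star (c • μ) = conj c • star μ := by
  refine Subtype.ext (VectorMeasure.ext fun A hA => ?_)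
  change cstar (c • μ.1) A = conj c * cstar μ.1 A
  rw [cstar_apply _ hA, cstar_apply _ hA, ← map_mul]
  rfl

theorem norm_star' (μ : M S) : ‖star μ‖ = ‖μ‖ := by
  rw [norm_def, norm_def, var_star, measureReal_def, measureReal_def,
    Measure.map_apply measurable_star' MeasurableSet.univ, Set.preimage_univ]

theorem int_star (μ : M S) {f : S → ℂ} (hf : Continuous f) {C : ℝ} (hC : ∀ x, ‖f x‖ ≤ C) :
    (star μ).int f = conj (μ.int fun x => conj (f (star x))) := by
  have hg : Continuous fun x => conj (f (star x)) :=
    Complex.continuous_conj.comp (hf.comp continuous_star)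
  have hgC : ∀ x, ‖conj (f (star x))‖ ≤ C := fun x => by rw [RCLike.norm_conj]; exact hC _
  induction μ using M.ind with
  | pos n =>
    have : (n.map star).Regular := regular_map (m := n) continuous_star
    rw [star_ofM, int_ofM, int_ofM, integral_map measurable_star'.aemeasurable
      hf.aestronglyMeasurable, integral_conj, Complex.conj_conj]
  | add μ ν h1 h2 => rw [M.star_add', int_add _ _ hf hC, int_add _ _ hg hgC, h1, h2, map_add]
  | smul d μ h => rw [M.star_smul', int_smul _ _ hf hC, int_smul _ _ hg hgC, h, map_mul]

end Star

section StarSemi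
variable [Semigroup S] [ContinuousMul S] [StarMul S] [ContinuousStar S]

theorem M.star_mul' (μ ν : M S) : star (μ * ν) = star ν * star μ := by
  refine M.ext_bdd fun f hf C hC => ?_
  have hg : Continuous fun x => conj (f (star x)) :=
    Complex.continuous_conj.comp (hf.comp continuous_star)
  have hgC : ∀ x, ‖conj (f (star x))‖ ≤ C := fun x => by rw [RCLike.norm_conj]; exact hC _
  have hr : ∀ y, Continuous fun x => f (x * y) := fun y => hf.comp (continuous_mul_const y)
  have hk : Continuous fun p : S × S => conj (f (star p.2 * star p.1)) := by
    refine Complex.continuous_conj.comp (hf.comp ?_)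
    exact (continuous_star.comp continuous_snd).mul (continuous_star.comp continuous_fst)
  have hkC : ∀ x y : S, ‖conj (f (star y * star x))‖ ≤ C := fun x y => by
    rw [RCLike.norm_conj]; exact hC _
  have h1 : (star (μ * ν)).int f = conj (ν.int fun y => μ.int fun x =>
      conj (f (star y * star x))) := by
    rw [int_star _ hf hC, conv_spec _ _ hg hgC]
    simp only [star_mul]
  have h2 : ∀ z, ((star ν).int fun x => f (x * star z)) =
      conj (ν.int fun y => conj (f (star y * star z))) := fun z =>
    int_star ν (hr (star z)) (fun x => hC _)
  have h3 : (star ν * star μ).int f = conj (μ.int fun x => ν.int fun y =>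
      conj (f (star y * star x))) := by
    rw [conv_spec _ _ hf hC, int_star _ (continuous_inner _ hf hC) (bound_inner _ hC)]
    simp only [h2, Complex.conj_conj]
  rw [h1, h3, int_fubini μ ν (H := fun x y => conj (f (star y * star x))) hk hkC]

instance : StarRing (M S) where
  star_involutive μ := Subtype.ext (cstar_cstar μ.1)
  star_mul := M.star_mul'
  star_add := M.star_add'

instance : StarModule ℂ (M S) := ⟨M.star_smul'⟩

end StarSemi

end Algebra

section Solid

variable {S : Type*} [TopologicalSpace S] [T2Space S] [MeasurableSpace S] [BorelSpace S]

theorem ofM_congr {m n : Measure S} [IsFiniteMeasure m] [m.Regular] [IsFiniteMeasure n]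
    [n.Regular] (h : m = n) : ofM m = ofM n := by subst h; rfl

theorem ofM_add (m n : Measure S) [IsFiniteMeasure m] [m.Regular] [IsFiniteMeasure n]
    [n.Regular] [(m + n).Regular] : ofM (m + n) = ofM m + ofM n :=
  Subtype.ext (toC_add m n)

theorem norm_ofM (m : Measure S) [IsFiniteMeasure m] [m.Regular] :
    ‖ofM m‖ = m.real Set.univ := by rw [norm_def, var_ofM]

theorem ofM_zero : ofM (0 : Measure S) = 0 := by
  rw [← norm_eq_zero, norm_ofM]; simp

/-- The values of a real functional on the positive measures below `n`. -/
def lowerVals (r : M S →L[ℝ] ℝ) (n : Measure S) : Set ℝ :=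
  {t | ∃ l : Measure S, ∃ _ : IsFiniteMeasure l, ∃ _ : l.Regular, l ≤ n ∧ r (ofM l) = t}

theorem lowerVals_bdd (r : M S →L[ℝ] ℝ) (n : Measure S) [IsFiniteMeasure n] {t : ℝ}
    (ht : t ∈ lowerVals r n) : t ≤ ‖r‖ * n.real Set.univ := by
  obtain ⟨l, _, _, hl, rfl⟩ := ht
  refine (le_abs_self _).trans ((r.le_opNorm _).trans ?_)
  rw [norm_ofM]
  exact mul_le_mul_of_nonneg_left (ENNReal.toReal_mono (measure_ne_top _ _) (hl _)) (norm_nonneg _)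

theorem lowerVals_zero (r : M S →L[ℝ] ℝ) (n : Measure S) : (0 : ℝ) ∈ lowerVals r n :=
  ⟨0, inferInstance, inferInstance, Measure.zero_le _, by rw [ofM_zero, map_zero]⟩

/-- The positive part of a real functional, on positive measures. -/
def posPart (r : M S →L[ℝ] ℝ) (n : Measure S) : ℝ := sSup (lowerVals r n)

theorem le_posPart (r : M S →L[ℝ] ℝ) (n l : Measure S) [IsFiniteMeasure n] [IsFiniteMeasure l]
    [l.Regular] (h : l ≤ n) : r (ofM l) ≤ posPart r n :=
  le_csSup ⟨_, fun _ ht => lowerVals_bdd r n ht⟩ ⟨l, inferInstance, inferInstance, h, rfl⟩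

theorem posPart_nonneg (r : M S →L[ℝ] ℝ) (n : Measure S) [IsFiniteMeasure n] :
    0 ≤ posPart r n :=
  le_csSup ⟨_, fun _ ht => lowerVals_bdd r n ht⟩ (lowerVals_zero r n)

theorem posPart_le (r : M S →L[ℝ] ℝ) (n : Measure S) [IsFiniteMeasure n] :
    posPart r n ≤ ‖r‖ * n.real Set.univ :=
  csSup_le ⟨0, lowerVals_zero r n⟩ fun _ ht => lowerVals_bdd r n ht

theorem posPart_add (r : M S →L[ℝ] ℝ) (m n : Measure S) [IsFiniteMeasure m] [m.Regular]
    [IsFiniteMeasure n] [n.Regular] : posPart r (m + n) = posPart r m + posPart r n := by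
  refine le_antisymm (csSup_le ⟨0, lowerVals_zero r _⟩ ?_) ?_
  · rintro t ⟨l, hf, hr, hl, rfl⟩
    have hac : l ≪ m + n := Measure.absolutelyContinuous_of_le hl
    set h : S → ℝ≥0∞ := fun x => min (l.rnDeriv (m + n) x) 1 with hh
    have hmeas : Measurable h := (Measure.measurable_rnDeriv l (m + n)).min measurable_const
    have h1 : (m + n).withDensity h = l := by
      rw [← Measure.withDensity_rnDeriv_eq l (m + n) hac]
      refine withDensity_congr_ae ?_
      filter_upwards [Measure.rnDeriv_le_one_of_le hl] with x hx
      simp only [hh]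
      exact min_eq_left hx
    have hle : ∀ k : Measure S, k.withDensity h ≤ k := fun k => by
      conv_rhs => rw [← withDensity_one (μ := k)]
      exact withDensity_mono (Eventually.of_forall fun x => min_le_right _ _)
    have e : m.withDensity h + n.withDensity h = l := by
      rw [← h1, withDensity_add_measure]
    have f1 : IsFiniteMeasure (m.withDensity h) := isFiniteMeasure_of_le _ (hle m)
    have f2 : IsFiniteMeasure (n.withDensity h) := isFiniteMeasure_of_le _ (hle n)
    have r1 : (m.withDensity h).Regular := regular_of_le (hle m)
    have r2 : (n.withDensity h).Regular := regular_of_le (hle n)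
    have r3 : (m.withDensity h + n.withDensity h).Regular := regular_add
    rw [← ofM_congr e, ofM_add, map_add]
    exact add_le_add (le_posPart r m _ (hle m)) (le_posPart r n _ (hle n))
  · rw [← le_sub_iff_add_le]
    refine csSup_le ⟨0, lowerVals_zero r _⟩ ?_
    rintro t ⟨l, hf, hr, hl, rfl⟩
    rw [le_sub_comm]
    refine csSup_le ⟨0, lowerVals_zero r _⟩ ?_
    rintro t ⟨k, hf', hr', hk, rfl⟩
    rw [le_sub_iff_add_le, add_comm, ← map_add]
    have : (l + k).Regular := regular_add
    rw [← ofM_add]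
    exact le_posPart r (m + n) (l + k) (add_le_add hl hk)

theorem exists_re_decomp (μ : M S) : ∃ a b : Measure S, IsFiniteMeasure a ∧ IsFiniteMeasure b ∧
    a.Regular ∧ b.Regular ∧ a ≤ μ.var ∧ b ≤ μ.var ∧
    ∀ A, MeasurableSet A → (μ.1 A).re = a.real A - b.real A := by
  obtain ⟨m, hf, hr, hle, he⟩ := exists_decomp_M μ
  refine ⟨m 0, m 1, hf 0, hf 1, hr 0, hr 1, hle 0, hle 1, fun A hA => ?_⟩
  have : μ.1 = toC (m 0) - toC (m 1) + Complex.I • (toC (m 2) - toC (m 3)) :=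
    congrArg Subtype.val he
  rw [this]
  simp [toC_apply _ hA]

/-- An additive bounded function on positive regular measures extends to a real functional. -/
theorem exists_extend (p : Measure S → ℝ) {C : ℝ}
    (hadd : ∀ (m n : Measure S) [IsFiniteMeasure m] [m.Regular] [IsFiniteMeasure n] [n.Regular],
      p (m + n) = p m + p n)
    (hbd : ∀ (m : Measure S) [IsFiniteMeasure m] [m.Regular], |p m| ≤ C * m.real Set.univ)
    (hC : 0 ≤ C) :
    ∃ r : M S →L[ℝ] ℝ, ∀ (n : Measure S) [IsFiniteMeasure n] [n.Regular], r (ofM n) = p n := by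
  choose a b hfa hfb hra hrb hla hlb hab using exists_re_decomp (S := S)
  have wd : ∀ (μ : M S) (c d : Measure S) [IsFiniteMeasure c] [c.Regular] [IsFiniteMeasure d]
      [d.Regular], (∀ A, MeasurableSet A → (μ.1 A).re = c.real A - d.real A) →
      p (a μ) - p (b μ) = p c - p d := by
    intro μ c d _ _ _ _ h
    have e : a μ + d = c + b μ := by
      refine Measure.ext fun A hA => ?_
      have h1 := (hab μ A hA).symm.trans (h A hA)
      have h2 : (a μ + d).real A = (c + b μ).real A := by
        rw [measureReal_add_apply, measureReal_add_apply]; linarith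
      exact (ENNReal.toReal_eq_toReal_iff' (measure_ne_top _ _) (measure_ne_top _ _)).1 h2
    have := congrArg p e
    rw [hadd, hadd] at this
    linarith
  let f : M S →+ ℝ := AddMonoidHom.mk' (fun μ => p (a μ) - p (b μ)) fun μ ν => by
    have r1 : (a μ + a ν).Regular := regular_add
    have r2 : (b μ + b ν).Regular := regular_add
    rw [wd (μ + ν) (a μ + a ν) (b μ + b ν) ?_, hadd, hadd]
    · ring
    · intro A hA
      rw [measureReal_add_apply, measureReal_add_apply]
      have h1 : ((μ + ν).1 A).re = (μ.1 A).re + (ν.1 A).re := rfl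
      rw [h1, hab μ A hA, hab ν A hA]; ring
  have hf : ∀ μ, ‖f μ‖ ≤ (2 * C) * ‖μ‖ := fun μ => by
    have h1 := hbd (a μ)
    have h2 := hbd (b μ)
    have h3 : (a μ).real Set.univ ≤ ‖μ‖ := ENNReal.toReal_mono (measure_ne_top _ _) (hla μ _)
    have h4 : (b μ).real Set.univ ≤ ‖μ‖ := ENNReal.toReal_mono (measure_ne_top _ _) (hlb μ _)
    calc ‖f μ‖ ≤ |p (a μ)| + |p (b μ)| := abs_sub _ _
      _ ≤ C * ‖μ‖ + C * ‖μ‖ := add_le_add (h1.trans (mul_le_mul_of_nonneg_left h3 hC))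
          (h2.trans (mul_le_mul_of_nonneg_left h4 hC))
      _ = (2 * C) * ‖μ‖ := by ring
  refine ⟨f.toRealLinearMap (AddMonoidHomClass.continuous_of_bound f _ hf), fun n _ _ => ?_⟩
  have hp0 : p 0 = 0 := by
    have := hbd 0
    simp at this
    exact this
  change p (a (ofM n)) - p (b (ofM n)) = p n
  rw [wd (ofM n) n 0, hp0, sub_zero]
  intro A hA
  have : (ofM n).1 A = (n.real A : ℂ) := toC_apply n hA
  rw [this]; simp

section Density

variable (m : Measure S) [IsFiniteMeasure m] [m.Regular]

theorem regular_density {h : S → ℂ} (hh : Integrable h m) :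
    (VectorMeasure.variation (m.withDensityᵥ h)) ≤ m.withDensity fun x => ‖h x‖ₑ := by
  refine VectorMeasure.variation_le_of_forall_enorm_le fun A hA => ?_
  rw [withDensityᵥ_apply hh hA, withDensity_apply _ hA]
  exact enorm_integral_le_lintegral_enorm _

theorem regular_density' {h : S → ℂ} (hh : Integrable h m) :
    (VectorMeasure.variation (m.withDensityᵥ h)).Regular :=
  regular_of_ac (m := m) ((Measure.absolutelyContinuous_of_le (regular_density m hh)).trans
    (withDensity_absolutelyContinuous _ _))

/-- The measure `h m`. -/
def densM (h : S → ℂ) (hh : Integrable h m) : M S := ⟨m.withDensityᵥ h, regular_density' m hh⟩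

theorem norm_densM_le {h : S → ℂ} (hh : Integrable h m) : ‖densM m h hh‖ ≤ ∫ x, ‖h x‖ ∂m := by
  rw [norm_def, measureReal_def, integral_norm_eq_lintegral_enorm hh.1]
  refine ENNReal.toReal_mono hh.2.ne ?_
  refine (regular_density m hh Set.univ).trans_eq ?_
  rw [withDensity_apply _ MeasurableSet.univ, Measure.restrict_univ]

theorem integrable_lp (h : Lp ℝ 2 m) : Integrable (fun x => ((h x : ℝ) : ℂ)) m :=
  ((Lp.memLp h).integrable (by norm_num)).ofReal

/-- Functionals on densities are represented by square integrable functions. -/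
theorem exists_repr (r : M S →L[ℝ] ℝ) : ∃ f : S → ℝ, Integrable f m ∧
    ∀ (l : Measure S) [IsFiniteMeasure l] [l.Regular], l ≤ m →
      Integrable (fun x => f x * (l.rnDeriv m x).toReal) m ∧
      r (ofM l) = ∫ x, f x * (l.rnDeriv m x).toReal ∂m := by
  let T₀ : Lp ℝ 2 m →ₗ[ℝ] ℝ :=
    { toFun := fun h => r (densM m _ (integrable_lp m h))
      map_add' := fun h k => by
        rw [← map_add]
        congr 1
        refine Subtype.ext ?_
        change m.withDensityᵥ _ = m.withDensityᵥ _ + m.withDensityᵥ _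
        rw [← withDensityᵥ_add (integrable_lp m h) (integrable_lp m k)]
        refine WithDensityᵥEq.congr_ae ?_
        filter_upwards [Lp.coeFn_add h k] with x hx
        change (((h + k : Lp ℝ 2 m) x : ℝ) : ℂ) = ((h x : ℝ) : ℂ) + ((k x : ℝ) : ℂ)
        rw [hx, Pi.add_apply, Complex.ofReal_add]
      map_smul' := fun c h => by
        rw [← map_smul]
        congr 1
        refine Subtype.ext ?_
        change m.withDensityᵥ _ = (c : ℂ) • m.withDensityᵥ _
        rw [← withDensityᵥ_smul]
        refine WithDensityᵥEq.congr_ae ?_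
        filter_upwards [Lp.coeFn_smul c h] with x hx
        simp [hx] }
  have hT : ∀ h, ‖T₀ h‖ ≤ (‖r‖ * (m Set.univ ^ (1 / 2 : ℝ)).toReal) * ‖h‖ := fun h => by
    refine (r.le_opNorm _).trans ?_
    rw [mul_assoc]
    refine mul_le_mul_of_nonneg_left ((norm_densM_le m _).trans ?_) (norm_nonneg _)
    have h1 := eLpNorm_le_eLpNorm_mul_rpow_measure_univ (μ := m) (p := 1) (q := 2)
      (f := h) (by norm_num) (Lp.aestronglyMeasurable h)
    rw [Lp.norm_def, mul_comm, ← ENNReal.toReal_mul]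
    simp only [Complex.norm_real]
    rw [integral_norm_eq_lintegral_enorm (Lp.aestronglyMeasurable h), ← eLpNorm_one_eq_lintegral_enorm]
    refine ENNReal.toReal_mono (ENNReal.mul_ne_top (Lp.eLpNorm_ne_top h) ?_) (h1.trans_eq ?_)
    · exact ENNReal.rpow_ne_top_of_nonneg (by norm_num) (measure_ne_top _ _)
    · norm_num
  let T : Lp ℝ 2 m →L[ℝ] ℝ := T₀.mkContinuous _ hT
  let g : Lp ℝ 2 m := (InnerProductSpace.toDual ℝ (Lp ℝ 2 m)).symm T
  refine ⟨g, (Lp.memLp g).integrable (by norm_num), fun l _ _ hl => ?_⟩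
  have hb : ∀ᵐ x ∂m, ‖(l.rnDeriv m x).toReal‖ ≤ 1 := by
    filter_upwards [Measure.rnDeriv_le_one_of_le hl] with x hx
    rw [Real.norm_of_nonneg ENNReal.toReal_nonneg]
    exact ENNReal.toReal_le_of_le_ofReal zero_le_one (by simpa using hx)
  have hmem : MemLp (fun x => (l.rnDeriv m x).toReal) 2 m :=
    MemLp.of_bound (Measure.measurable_rnDeriv l m).ennreal_toReal.aestronglyMeasurable 1 hb
  have e1 : r (ofM l) = T (hmem.toLp _) := by
    change r (ofM l) = r (densM m _ (integrable_lp m _))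
    congr 1
    refine Subtype.ext (VectorMeasure.ext fun A hA => ?_)
    change toC l A = m.withDensityᵥ _ A
    rw [withDensityᵥ_apply (integrable_lp m _) hA, toC_apply l hA, integral_complex_ofReal]
    congr 1
    rw [← Measure.setIntegral_toReal_rnDeriv (Measure.absolutelyContinuous_of_le hl)]
    refine integral_congr_ae (ae_restrict_of_ae ?_)
    filter_upwards [hmem.coeFn_toLp] with x hx
    rw [hx]
  have e2 : T (hmem.toLp _) = inner ℝ g (hmem.toLp _) := by
    rw [← InnerProductSpace.toDual_apply_apply (𝕜 := ℝ)]
    simp [g]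
  constructor
  · have := ((Lp.memLp g).integrable (q := 2) (by norm_num)).mul_bdd (c := 1)
      hmem.1 hb
    simpa [mul_comm] using this
  · rw [e1, e2, L2.inner_def]
    refine integral_congr_ae ?_
    filter_upwards [hmem.coeFn_toLp] with x hx
    rw [hx]
    simp [mul_comm]

variable [LocallyCompactSpace S]

theorem exists_cc_approx {f : S → ℝ} (hf : Integrable f m) {ε : ℝ} (hε : 0 < ε) :
    ∃ g : S → ℝ, HasCompactSupport g ∧ (∫ x, ‖f x - g x‖ ∂m) ≤ ε ∧ Continuous g ∧
      Integrable g m := by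
  have key : ∃ g : S → ℝ, eLpNorm (f - g) 1 m ≤ ENNReal.ofReal ε ∧
      (HasCompactSupport g ∧ Continuous g ∧ Integrable g m) := by
    refine MemLp.induction_dense (P := fun g : S → ℝ =>
      HasCompactSupport g ∧ Continuous g ∧ Integrable g m) ENNReal.one_ne_top ?_ ?_ ?_
      (memLp_one_iff_integrable.2 hf) (by simpa using hε)
    · intro c t ht htm δ hδ
      obtain ⟨η, ηpos, hη⟩ := exists_eLpNorm_indicator_le (μ := m) ENNReal.one_ne_top c hδ
      have hη' : ((η / 2 : ℝ≥0) : ℝ≥0∞) ≠ 0 := by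
        have : (0 : ℝ≥0) < η / 2 := half_pos ηpos
        exact_mod_cast this.ne'
      obtain ⟨K, hKt, hK, hKm⟩ := ht.exists_isCompact_sdiff_lt htm.ne hη'
      obtain ⟨V, hV, hVo, -, hVm⟩ := ht.exists_isOpen_sdiff_lt htm.ne hη'
      obtain ⟨a, ha1, ha0, hac, ha⟩ := exists_continuous_one_zero_of_isCompact hK
        hVo.isClosed_compl (Set.disjoint_compl_right_iff_subset.2 (hKt.trans hV))
      refine ⟨fun x => a x * c, ?_, hac.mul_right, a.continuous.mul continuous_const,
        integrable_of_bdd (C := |c|) (a.continuous.mul continuous_const) fun x => ?_⟩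
      · refine (eLpNorm_mono (g := (V \ K).indicator fun _ => c) fun x => ?_).trans (hη _ ?_)
        · by_cases hx : x ∈ K
          · have : a x = 1 := ha1 hx
            simp [hx, hKt hx, this]
          · by_cases hxV : x ∈ V
            · have hm : x ∈ V \ K := ⟨hxV, hx⟩
              rw [Set.indicator_of_mem hm]
              by_cases hxt : x ∈ t
              · have : a x * c - c = -((1 - a x) * c) := by ring
                simp only [Pi.sub_apply, Set.indicator_of_mem hxt]
                rw [this, norm_neg, norm_mul]
                refine mul_le_of_le_one_left (norm_nonneg _) ?_
                rw [Real.norm_of_nonneg] <;> linarith [(ha x).1, (ha x).2]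
              · simp only [Pi.sub_apply, Set.indicator_of_notMem hxt, sub_zero]
                rw [norm_mul, Real.norm_of_nonneg (ha x).1]
                exact mul_le_of_le_one_left (norm_nonneg _) (ha x).2
            · have h0 : a x = 0 := ha0 hxV
              have : x ∉ t := fun h => hxV (hV h)
              simp [h0, this]
        · have : V \ K ⊆ (V \ t) ∪ (t \ K) := fun x hx => by
            by_cases h : x ∈ t
            · exact Or.inr ⟨h, hx.2⟩
            · exact Or.inl ⟨hx.1, h⟩
          refine (measure_mono this).trans ((measure_union_le _ _).trans
            ((add_le_add hVm.le hKm.le).trans_eq ?_))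
          rw [← ENNReal.coe_add, add_halves]
      · rw [norm_mul, Real.norm_of_nonneg (ha x).1]
        exact mul_le_of_le_one_left (norm_nonneg _) (ha x).2
    · rintro f g ⟨h1, h2, h3⟩ ⟨h4, h5, h6⟩
      exact ⟨h1.add h4, h2.add h5, h3.add h6⟩
    · rintro f ⟨-, -, h⟩
      exact h.1
  obtain ⟨g, hg, h1, h2, h3⟩ := key
  refine ⟨g, h1, ?_, h2, h3⟩
  rw [eLpNorm_one_eq_lintegral_enorm] at hg
  change ∫ x, ‖(f - g) x‖ ∂m ≤ ε
  rw [integral_norm_eq_lintegral_enorm (hf.sub h3).1]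
  exact ENNReal.toReal_le_of_le_ofReal hε.le hg

theorem exists_approx (r : M S →L[ℝ] ℝ) {ε : ℝ} (hε : 0 < ε) : ∃ φ : C_c(S, ℝ),
    ∀ (l : Measure S) [IsFiniteMeasure l] [l.Regular], l ≤ m →
      |r (ofM l) - ∫ x, φ x ∂l| ≤ ε := by
  obtain ⟨f, hf, hr⟩ := exists_repr m r
  obtain ⟨g, hgc, hgi, hg, hgm⟩ := exists_cc_approx m hf hε
  refine ⟨⟨⟨g, hg⟩, hgc⟩, fun l _ _ hl => ?_⟩
  change |r (ofM l) - ∫ x, g x ∂l| ≤ ε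
  obtain ⟨hi, he⟩ := hr l hl
  have hb : ∀ᵐ x ∂m, (l.rnDeriv m x).toReal ≤ 1 := by
    filter_upwards [Measure.rnDeriv_le_one_of_le hl] with x hx
    exact ENNReal.toReal_le_of_le_ofReal zero_le_one (by simpa using hx)
  have e2 : ∫ x, g x ∂l = ∫ x, g x * (l.rnDeriv m x).toReal ∂m := by
    rw [← integral_rnDeriv_smul (Measure.absolutelyContinuous_of_le hl)]
    simp [mul_comm]
  have hi2 : Integrable (fun x => g x * (l.rnDeriv m x).toReal) m := by
    refine hgm.mul_bdd (c := 1)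
      (Measure.measurable_rnDeriv l m).ennreal_toReal.aestronglyMeasurable ?_
    filter_upwards [hb] with x hx
    rwa [Real.norm_of_nonneg ENNReal.toReal_nonneg]
  rw [he, e2, ← integral_sub hi hi2]
  refine le_trans ?_ hgi
  rw [← Real.norm_eq_abs]
  refine norm_integral_le_of_norm_le (hf.sub hgm).norm ?_
  filter_upwards [hb] with x hx
  rw [← sub_mul, norm_mul, Real.norm_of_nonneg ENNReal.toReal_nonneg]
  exact mul_le_of_le_one_right (norm_nonneg _) hx

end Density

variable [LocallyCompactSpace S]

/-- Integration of a compactly supported function, as a real functional. -/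
theorem exists_int_functional (φ : C_c(S, ℝ)) : ∃ r : M S →L[ℝ] ℝ,
    ∀ (n : Measure S) [IsFiniteMeasure n] [n.Regular], r (ofM n) = ∫ x, φ x ∂n := by
  obtain ⟨C, hC⟩ := φ.hasCompactSupport.exists_bound_of_continuous φ.continuous
  refine exists_extend (fun n => ∫ x, φ x ∂n) (C := |C|) (fun m n _ _ _ _ => ?_)
    (fun m _ _ => ?_) (abs_nonneg _)
  · exact integral_add_measure (integrable_of_bdd φ.continuous hC)
      (integrable_of_bdd φ.continuous hC)
  · rw [← Real.norm_eq_abs]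
    refine (norm_integral_le_of_norm_le_const (Eventually.of_forall hC)).trans ?_
    exact mul_le_mul_of_nonneg_right (le_abs_self _) measureReal_nonneg

theorem abs_posPart_le (r : M S →L[ℝ] ℝ) (n : Measure S) [IsFiniteMeasure n] :
    |posPart r n| ≤ ‖r‖ * n.real Set.univ := by
  rw [abs_of_nonneg (posPart_nonneg r n)]; exact posPart_le r n

/-- Weak continuity passes from a family of positive measures to a vaguely continuous dominated
family. -/
theorem solid {Y : Type*} [TopologicalSpace Y] (m l : Y → Measure S)
    [∀ y, IsFiniteMeasure (m y)] [∀ y, (m y).Regular] [∀ y, IsFiniteMeasure (l y)]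
    [∀ y, (l y).Regular] (hlm : ∀ y, l y ≤ m y)
    (hm : ∀ r : M S →L[ℝ] ℝ, Continuous fun y => r (ofM (m y)))
    (hl : ∀ φ : C_c(S, ℝ), Continuous fun y => ∫ x, φ x ∂(l y)) (r : M S →L[ℝ] ℝ) :
    Continuous fun y => r (ofM (l y)) := by
  rw [continuous_iff_continuousAt]
  intro y₀
  rw [Metric.continuousAt_iff']
  intro ε hε
  obtain ⟨φ, hφ⟩ := exists_approx (m y₀) r (ε := ε / 8) (by positivity)
  obtain ⟨s, hs⟩ := exists_int_functional φ
  have hp : ∀ t : M S →L[ℝ] ℝ, (∀ (l' : Measure S) [IsFiniteMeasure l'] [l'.Regular], l' ≤ m y₀ →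
      t (ofM l') ≤ ε / 8) → ∀ᶠ y in 𝓝 y₀, t (ofM (l y)) < ε / 4 := by
    intro t ht
    obtain ⟨q, hq⟩ := exists_extend (posPart t) (C := ‖t‖) (fun m n _ _ _ _ => posPart_add t m n)
      (fun m _ _ => abs_posPart_le t m) (norm_nonneg _)
    have h0 : q (ofM (m y₀)) ≤ ε / 8 := by
      rw [hq]
      refine csSup_le ⟨0, lowerVals_zero _ _⟩ ?_
      rintro _ ⟨l', _, _, h, rfl⟩
      exact ht l' h
    filter_upwards [(hm q).continuousAt.eventually_lt (continuousAt_const (y := ε / 4))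
      (by linarith)] with y hy
    exact ((le_posPart t (m y) (l y) (hlm y)).trans_eq (hq (m y)).symm).trans_lt hy
  have e1 := hp (r - s) fun l' _ _ h => by
    have := hφ l' h
    rw [sub_apply, hs]
    exact (le_abs_self _).trans this
  have e2 := hp (s - r) fun l' _ _ h => by
    have := hφ l' h
    rw [abs_sub_comm] at this
    rw [sub_apply, hs]
    exact (le_abs_self _).trans this
  have e3 : ∀ᶠ y in 𝓝 y₀, dist (∫ x, φ x ∂(l y)) (∫ x, φ x ∂(l y₀)) < ε / 4 :=
    Metric.continuousAt_iff'.1 (hl φ).continuousAt _ (by positivity)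
  have e4 := hφ (l y₀) (hlm y₀)
  filter_upwards [e1, e2, e3] with y h1 h2 h3
  rw [sub_apply, hs] at h1 h2
  rw [Real.dist_eq, abs_lt] at *
  rw [abs_le] at e4
  constructor <;> linarith [e4.1, e4.2, h3.1, h3.2]

end Solid

section LS

variable {S : Type*} [TopologicalSpace S] [T2Space S] [MeasurableSpace S] [BorelSpace S]

/-- The point mass `δ_x`. -/
def dirac (x : S) : M S := @ofM S _ _ _ _ (Measure.dirac x) _ (regular_dirac x)

/-- The total variation `|μ|` as an element of `M(S)`. -/
def M.abs (μ : M S) : M S := ofM μ.var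

/-- Continuity of an `M(S)`-valued map for the weak topology `σ(M(S), M(S)*)`. -/
def WeaklyContinuous {Y : Type*} [TopologicalSpace Y] (f : Y → M S) : Prop :=
  Continuous fun y => toWeakSpace ℂ (M S) (f y)

theorem weaklyContinuous_iff {Y : Type*} [TopologicalSpace Y] (f : Y → M S) :
    WeaklyContinuous f ↔ ∀ r : M S →L[ℝ] ℝ, Continuous fun y => r (f y) := by
  constructor
  · intro h r
    let F : StrongDual ℂ (M S) := StrongDual.extendRCLike r
    have h1 : Continuous fun y => F (f y) :=
      (WeakBilin.eval_continuous (topDualPairing ℂ (M S)).flip F).comp h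
    have h2 : ∀ μ, r μ = (F μ).re := fun μ => by
      simp [F, StrongDual.extendRCLike_apply]
    simp only [h2]
    exact Complex.continuous_re.comp h1
  · intro h
    refine WeakBilin.continuous_of_continuous_eval _ fun F => ?_
    change Continuous fun y => F (f y)
    have h1 := h (Complex.reCLM.comp (F.restrictScalars ℝ))
    have h2 := h (Complex.imCLM.comp (F.restrictScalars ℝ))
    have : (fun y => F (f y)) = fun y => (((F (f y)).re : ℝ) : ℂ) + ((F (f y)).im : ℝ) * Complex.I := by
      ext y; rw [Complex.re_add_im]
    rw [this]
    exact (Complex.continuous_ofReal.comp h1).add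
      ((Complex.continuous_ofReal.comp h2).mul continuous_const)

theorem WeaklyContinuous.clm {Y : Type*} [TopologicalSpace Y] {f : Y → M S}
    (h : WeaklyContinuous f) (T : M S →L[ℝ] M S) : WeaklyContinuous fun y => T (f y) := by
  rw [weaklyContinuous_iff] at *
  exact fun r => h (r.comp T)

theorem WeaklyContinuous.add {Y : Type*} [TopologicalSpace Y] {f g : Y → M S}
    (hf : WeaklyContinuous f) (hg : WeaklyContinuous g) :
    WeaklyContinuous fun y => f y + g y := by
  rw [weaklyContinuous_iff] at *
  intro r
  simp only [map_add]
  exact (hf r).add (hg r)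

variable [LocallyCompactSpace S]

section MulOnly
variable [Mul S] [ContinuousMul S]

theorem ofM_mul_ofM (m n : Measure S) [IsFiniteMeasure m] [m.Regular] [IsFiniteMeasure n]
    [n.Regular] : ∃ (k : Measure S) (_ : IsFiniteMeasure k) (_ : k.Regular),
      ofM m * ofM n = ofM k ∧ k Set.univ ≤ m Set.univ * n Set.univ := by
  obtain ⟨k, h1, h2, h3, h4⟩ := exists_conv_pos m n
  refine ⟨k, h1, h2, M.ext_bdd fun f hf C hC => ?_, h3⟩
  rw [conv_spec _ _ hf hC]
  simpa only [int_ofM] using (h4 f hf ⟨C, hC⟩).symm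

theorem norm_ofM_mul_le (m n : Measure S) [IsFiniteMeasure m] [m.Regular] [IsFiniteMeasure n]
    [n.Regular] : ‖ofM m * ofM n‖ ≤ ‖ofM m‖ * ‖ofM n‖ := by
  obtain ⟨k, h1, h2, h3, h4⟩ := ofM_mul_ofM m n
  rw [h3, norm_ofM, norm_ofM, norm_ofM, measureReal_def, measureReal_def, measureReal_def,
    ← ENNReal.toReal_mul]
  exact ENNReal.toReal_mono (ENNReal.mul_ne_top (measure_ne_top _ _) (measure_ne_top _ _)) h4

theorem mul_dirac (n : Measure S) [IsFiniteMeasure n] [n.Regular] (x : S) :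
    ofM n * dirac x = @ofM S _ _ _ _ (n.map (· * x)) inferInstance
      (regular_map (continuous_mul_const x)) := by
  have := regular_dirac x
  have := regular_map (m := n) (continuous_mul_const x)
  refine M.ext_bdd fun f hf C hC => ?_
  rw [conv_spec _ _ hf hC, dirac]
  simp only [int_ofM]
  rw [integral_map (continuous_mul_const x).measurable.aemeasurable hf.aestronglyMeasurable]
  have hc : Continuous fun y => ∫ z, f (z * y) ∂n := by
    simpa only [int_ofM] using continuous_inner (ofM n) hf hC
  rw [integral_dirac' _ _ hc.stronglyMeasurable]

theorem dirac_mul (n : Measure S) [IsFiniteMeasure n] [n.Regular] (x : S) :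
    dirac x * ofM n = @ofM S _ _ _ _ (n.map (x * ·)) inferInstance
      (regular_map (continuous_const_mul x)) := by
  have := regular_dirac x
  have := regular_map (m := n) (continuous_const_mul x)
  refine M.ext_bdd fun f hf C hC => ?_
  rw [conv_spec _ _ hf hC, dirac]
  simp only [int_ofM]
  rw [integral_map (continuous_const_mul x).measurable.aemeasurable hf.aestronglyMeasurable]
  congr 1 with y
  exact integral_dirac' _ _ (hf.comp (continuous_mul_const y)).stronglyMeasurable

/-- Both translation maps of `μ` are weakly continuous. -/
def TransCont (μ : M S) : Prop :=
  WeaklyContinuous (fun x => μ * dirac x) ∧ WeaklyContinuous (fun x => dirac x * μ)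

theorem TransCont.of_le {m n : Measure S} [IsFiniteMeasure m] [m.Regular] [IsFiniteMeasure n]
    [n.Regular] (hle : n ≤ m) (h : TransCont (ofM m)) : TransCont (ofM n) := by
  obtain ⟨h1, h2⟩ := h
  simp only [TransCont, weaklyContinuous_iff, mul_dirac, dirac_mul] at *
  have i1 : ∀ x : S, (m.map (· * x)).Regular := fun x => regular_map (continuous_mul_const x)
  have i2 : ∀ x : S, (n.map (· * x)).Regular := fun x => regular_map (continuous_mul_const x)
  have i3 : ∀ x : S, (m.map (x * ·)).Regular := fun x => regular_map (continuous_const_mul x)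
  have i4 : ∀ x : S, (n.map (x * ·)).Regular := fun x => regular_map (continuous_const_mul x)
  constructor
  · refine solid (fun x => m.map (· * x)) (fun x => n.map (· * x))
      (fun x => Measure.map_mono hle (continuous_mul_const x).measurable) h1 fun φ => ?_
    obtain ⟨C, hC⟩ := φ.hasCompactSupport.exists_bound_of_continuous φ.continuous
    have e : ∀ x, ∫ z, φ z ∂(n.map (· * x)) = ∫ z, φ (z * x) ∂n := fun x =>
      integral_map (continuous_mul_const x).measurable.aemeasurable
        φ.continuous.aestronglyMeasurable
    simp only [e]
    exact continuous_param n (H := fun x z => φ (z * x))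
      (φ.continuous.comp (continuous_snd.mul continuous_fst)) fun _ _ => hC _
  · refine solid (fun x => m.map (x * ·)) (fun x => n.map (x * ·))
      (fun x => Measure.map_mono hle (continuous_const_mul x).measurable) h2 fun φ => ?_
    obtain ⟨C, hC⟩ := φ.hasCompactSupport.exists_bound_of_continuous φ.continuous
    have e : ∀ x, ∫ z, φ z ∂(n.map (x * ·)) = ∫ z, φ (x * z) ∂n := fun x =>
      integral_map (continuous_const_mul x).measurable.aemeasurable
        φ.continuous.aestronglyMeasurable
    simp only [e]
    exact continuous_param n (H := fun x z => φ (x * z))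
      (φ.continuous.comp (continuous_fst.mul continuous_snd)) fun _ _ => hC _

end MulOnly

section Semi
variable [Semigroup S] [ContinuousMul S]

theorem norm_mul_le_16 (μ ν : M S) : ‖μ * ν‖ ≤ 16 * ‖μ‖ * ‖ν‖ := by
  have tri : ∀ (a b c d : M S), ‖a - b + Complex.I • (c - d)‖ ≤ ‖a‖ + ‖b‖ + (‖c‖ + ‖d‖) := by
    intro a b c d
    refine (norm_add_le _ _).trans (add_le_add (norm_sub_le _ _) ?_)
    rw [norm_smul, Complex.norm_I, one_mul]
    exact norm_sub_le _ _
  obtain ⟨m, hf, hr, hle, he⟩ := exists_decomp_M μ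
  obtain ⟨n, hf', hr', hle', he'⟩ := exists_decomp_M ν
  have bm : ∀ i, ‖ofM (m i)‖ ≤ ‖μ‖ := fun i => by
    rw [norm_ofM]; exact ENNReal.toReal_mono (measure_ne_top _ _) (hle i _)
  have bn : ∀ i, ‖ofM (n i)‖ ≤ ‖ν‖ := fun i => by
    rw [norm_ofM]; exact ENNReal.toReal_mono (measure_ne_top _ _) (hle' i _)
  have b1 : ∀ i j, ‖ofM (m i) * ofM (n j)‖ ≤ ‖μ‖ * ‖ν‖ := fun i j =>
    (norm_ofM_mul_le _ _).trans (mul_le_mul (bm i) (bn j) (norm_nonneg _) (norm_nonneg _))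
  have b2 : ∀ i, ‖ofM (m i) * ν‖ ≤ 4 * (‖μ‖ * ‖ν‖) := fun i => by
    have e : ofM (m i) * ν = ofM (m i) * ofM (n 0) - ofM (m i) * ofM (n 1) +
        Complex.I • (ofM (m i) * ofM (n 2) - ofM (m i) * ofM (n 3)) := by
      conv_lhs => rw [he']
      rw [mul_add, mul_sub, mul_smul_comm, mul_sub]
    rw [e]
    refine (tri _ _ _ _).trans ?_
    linarith [b1 i 0, b1 i 1, b1 i 2, b1 i 3]
  have e : μ * ν = ofM (m 0) * ν - ofM (m 1) * ν +
      Complex.I • (ofM (m 2) * ν - ofM (m 3) * ν) := by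
    conv_lhs => rw [he]
    rw [add_mul, sub_mul, smul_mul_assoc, sub_mul]
  rw [e]
  refine (tri _ _ _ _).trans ?_
  linarith [b2 0, b2 1, b2 2, b2 3]

/-- Left convolution as a real operator. -/
def mulLeftCLM (κ : M S) : M S →L[ℝ] M S :=
  (AddMonoidHom.mulLeft κ).toRealLinearMap
    (AddMonoidHomClass.continuous_of_bound _ (16 * ‖κ‖) fun ν => norm_mul_le_16 κ ν)

/-- Right convolution as a real operator. -/
def mulRightCLM (κ : M S) : M S →L[ℝ] M S :=
  (AddMonoidHom.mulRight κ).toRealLinearMap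
    (AddMonoidHomClass.continuous_of_bound _ (16 * ‖κ‖) fun ν =>
      (norm_mul_le_16 ν κ).trans_eq (by ring))

theorem TransCont.mul {μ ν : M S} (hμ : TransCont μ) (hν : TransCont ν) : TransCont (μ * ν) := by
  constructor
  · simp only [mul_assoc]
    exact hν.1.clm (mulLeftCLM μ)
  · simp only [← mul_assoc]
    exact hμ.2.clm (mulRightCLM ν)

theorem TransCont.add {μ ν : M S} (hμ : TransCont μ) (hν : TransCont ν) : TransCont (μ + ν) := by
  constructor
  · simp only [add_mul]
    exact hμ.1.add hν.1
  · simp only [mul_add]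
    exact hμ.2.add hν.2

theorem TransCont.smul {μ : M S} (c : ℝ≥0) (hμ : TransCont μ) : TransCont ((c : ℂ) • μ) := by
  have hc : WeaklyContinuous fun x => (c : ℂ) • (μ * dirac x) :=
    hμ.1.clm ((c : ℝ) • ContinuousLinearMap.id ℝ (M S))
  have hd : WeaklyContinuous fun x => (c : ℂ) • (dirac x * μ) :=
    hμ.2.clm ((c : ℝ) • ContinuousLinearMap.id ℝ (M S))
  constructor
  · simpa only [smul_mul_assoc] using hc
  · simpa only [mul_smul_comm] using hd

theorem smul_ofM (c : ℝ≥0) (n : Measure S) [IsFiniteMeasure n] [n.Regular] :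
    ofM (c • n) = (c : ℂ) • ofM n := by
  refine Subtype.ext (VectorMeasure.ext fun A hA => ?_)
  change toC (c • n) A = (c : ℂ) * toC n A
  rw [toC_apply _ hA, toC_apply _ hA, measureReal_def, measureReal_def, Measure.smul_apply,
    ENNReal.smul_def, smul_eq_mul, ENNReal.toReal_mul]
  push_cast
  rfl

variable (S) in
/-- The measures `μ` for which `x ↦ |μ| * δ_x` and `x ↦ δ_x * |μ|` are weakly continuous. -/
def LSubmodule : Submodule ℂ (M S) where
  carrier := {μ | TransCont μ.abs}
  zero_mem' := by
    have h : (0 : M S).abs = 0 := by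
      rw [M.abs, ← norm_eq_zero, norm_ofM, ← norm_def, norm_zero]
    change TransCont (0 : M S).abs
    rw [h]
    constructor <;> simp only [zero_mul, mul_zero] <;> exact continuous_const
  add_mem' := by
    intro μ ν hμ hν
    have := regular_add (m := μ.var) (n := ν.var)
    refine TransCont.of_le (var_add_le μ ν) ?_
    rw [ofM_add]
    exact TransCont.add hμ hν
  smul_mem' := by
    intro c μ hμ
    change TransCont (ofM (c • μ).var)
    rw [ofM_congr (var_smul c μ), smul_ofM]
    exact TransCont.smul _ hμ

theorem ofM_mem_LSubmodule {n : Measure S} [IsFiniteMeasure n] [n.Regular] :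
    ofM n ∈ LSubmodule S ↔ TransCont (ofM n) := by
  change TransCont (ofM (ofM n).var) ↔ _
  rw [ofM_congr (var_ofM n)]

theorem LSubmodule_ind {P : M S → Prop}
    (pos : ∀ (n : Measure S) [IsFiniteMeasure n] [n.Regular], TransCont (ofM n) → P (ofM n))
    (add : ∀ μ ν, P μ → P ν → P (μ + ν)) (smul : ∀ (c : ℂ) μ, P μ → P (c • μ)) {μ : M S}
    (hμ : μ ∈ LSubmodule S) : P μ := by
  obtain ⟨m, hf, hr, hle, he⟩ := exists_decomp_M μ
  rw [he]
  have hp : ∀ i, P (ofM (m i)) := fun i => pos _ (TransCont.of_le (hle i) hμ)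
  have hsub : ∀ μ ν, P μ → P ν → P (μ - ν) := fun μ ν h1 h2 => by
    rw [sub_eq_add_neg, ← neg_one_smul ℂ ν]
    exact add _ _ h1 (smul _ _ h2)
  exact add _ _ (hsub _ _ (hp _) (hp _)) (smul _ _ (hsub _ _ (hp _) (hp _)))

theorem LSubmodule_mul {μ ν : M S} (hμ : μ ∈ LSubmodule S) (hν : ν ∈ LSubmodule S) :
    μ * ν ∈ LSubmodule S := by
  refine LSubmodule_ind (P := fun μ => μ * ν ∈ LSubmodule S) (fun m _ _ hm => ?_)
    (fun μ₁ μ₂ h1 h2 => ?_) (fun c μ h => ?_) hμ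
  · refine LSubmodule_ind (P := fun ν => ofM m * ν ∈ LSubmodule S) (fun n _ _ hn => ?_)
      (fun μ₁ μ₂ h1 h2 => ?_) (fun c μ h => ?_) hν
    · obtain ⟨k, h1, h2, h3, h4⟩ := ofM_mul_ofM m n
      have := hm.mul hn
      rw [h3] at this ⊢
      exact ofM_mem_LSubmodule.2 this
    · rw [mul_add]; exact add_mem h1 h2
    · rw [mul_smul_comm]; exact Submodule.smul_mem _ _ h
  · rw [add_mul]; exact add_mem h1 h2
  · rw [smul_mul_assoc]; exact Submodule.smul_mem _ _ h

end Semi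

section StarSemi
variable [Semigroup S] [ContinuousMul S] [StarMul S] [ContinuousStar S]

theorem star_dirac (x : S) : star (dirac x) = dirac (star x) := by
  have := regular_dirac x
  have := regular_dirac (star x)
  rw [dirac, star_ofM]
  have e : (Measure.dirac x).map star = Measure.dirac (star x) :=
    Measure.map_dirac' measurable_star' x
  have := regular_map (m := Measure.dirac x) (continuous_star (R := S))
  exact ofM_congr e

/-- The involution as a real operator. -/
def starCLM : M S →L[ℝ] M S :=
  (starAddEquiv : M S ≃+ M S).toAddMonoidHom.toRealLinearMap
    (AddMonoidHomClass.continuous_of_bound _ 1 fun ν => by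
      rw [one_mul]; exact (norm_star' ν).le)

theorem WeaklyContinuous.comp {Y Z : Type*} [TopologicalSpace Y] [TopologicalSpace Z]
    {f : Y → M S} (h : WeaklyContinuous f) {g : Z → Y} (hg : Continuous g) :
    WeaklyContinuous fun z => f (g z) :=
  Continuous.comp (g := fun y => toWeakSpace ℂ (M S) (f y)) h hg

theorem TransCont.star {μ : M S} (hμ : TransCont μ) : TransCont (star μ) := by
  constructor
  · have h : WeaklyContinuous fun x => Star.star (dirac (Star.star x) * μ) :=
      (hμ.2.clm starCLM).comp continuous_star
    simpa only [star_mul, star_dirac, star_star] using h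
  · have h : WeaklyContinuous fun x => Star.star (μ * dirac (Star.star x)) :=
      (hμ.1.clm starCLM).comp continuous_star
    simpa only [star_mul, star_dirac, star_star] using h

variable (S) in
/-- `L(S)`: the measures `μ ∈ M(S)` for which `x ↦ |μ| * δ_x` and `x ↦ δ_x * |μ|` are continuous
from `S` to `M(S)` with its weak topology; it is a `*`-subalgebra of `M(S)`. -/
def L : NonUnitalStarSubalgebra ℂ (M S) where
  carrier := {μ | WeaklyContinuous (fun x => μ.abs * dirac x) ∧
    WeaklyContinuous (fun x => dirac x * μ.abs)}
  zero_mem' := (LSubmodule S).zero_mem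
  add_mem' h1 h2 := (LSubmodule S).add_mem h1 h2
  smul_mem' c _ h := (LSubmodule S).smul_mem c h
  mul_mem' h1 h2 := LSubmodule_mul h1 h2
  star_mem' := by
    intro μ hμ
    have e : (star μ).abs = star μ.abs := by
      have := regular_map (m := μ.var) (continuous_star (R := S))
      rw [M.abs, M.abs, star_ofM]
      exact ofM_congr (var_star μ)
    change TransCont (star μ).abs
    rw [e]
    exact TransCont.star hμ

end StarSemi
end LS

section Rep

universe u

variable (S : Type u) [TopologicalSpace S] [Semigroup S] [StarMul S]

/-- An element of `Σ(S)`: a `*`-representation `π` of `S` on a Hilbert space `H` with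
`‖π(x)‖ ≤ 1` for all `x` and with `x ↦ ⟨π(x)ξ, η⟩` continuous for all `ξ, η ∈ H`. It need not be
non-degenerate, nor need it preserve an identity. -/
structure StarRep where
  /-- The Hilbert space. -/
  H : Type u
  [normed : NormedAddCommGroup H]
  [innerProd : InnerProductSpace ℂ H]
  [complete : CompleteSpace H]
  /-- The operators of the representation. -/
  toFun : S → H →L[ℂ] H
  map_mul : ∀ x y, toFun (x * y) = toFun x * toFun y
  map_star : ∀ x, toFun (star x) = ContinuousLinearMap.adjoint (toFun x)
  norm_le_one : ∀ x, ‖toFun x‖ ≤ 1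
  weak_continuous : ∀ ξ η : H, Continuous fun x => inner ℂ η (toFun x ξ)

instance (π : StarRep S) : NormedAddCommGroup π.H := π.normed
instance (π : StarRep S) : InnerProductSpace ℂ π.H := π.innerProd
instance (π : StarRep S) : CompleteSpace π.H := π.complete

variable {S}
variable [T2Space S] [MeasurableSpace S] [BorelSpace S]

namespace StarRep

variable (π : StarRep S)

theorem bound (ξ η : π.H) (x : S) : ‖inner ℂ η (π.toFun x ξ)‖ ≤ ‖η‖ * ‖ξ‖ := by
  refine (norm_inner_le_norm _ _).trans (mul_le_mul_of_nonneg_left ?_ (norm_nonneg _))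
  exact ((π.toFun x).le_opNorm ξ).trans
    (mul_le_of_le_one_left (norm_nonneg _) (π.norm_le_one x))

/-- The sesquilinear form `(η, ξ) ↦ ∫ ⟨π(x)ξ, η⟩ dμ(x)`. -/
def form (μ : M S) : π.H →L⋆[ℂ] π.H →L[ℂ] ℂ :=
  LinearMap.mkContinuous₂
    (LinearMap.mk₂'ₛₗ (starRingEnd ℂ) (RingHom.id ℂ)
      (fun η ξ => μ.int fun x => inner ℂ η (π.toFun x ξ))
      (fun η₁ η₂ ξ => by
        simp only [inner_add_left]
        exact int_fun_add μ (π.weak_continuous _ _) (π.bound _ _) (π.weak_continuous _ _)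
          (π.bound _ _))
      (fun c η ξ => by
        simp only [inner_smul_left]
        exact int_fun_smul μ _ (π.weak_continuous _ _) (π.bound _ _))
      (fun η ξ₁ ξ₂ => by
        simp only [map_add, inner_add_right]
        exact int_fun_add μ (π.weak_continuous _ _) (π.bound _ _) (π.weak_continuous _ _)
          (π.bound _ _))
      (fun c η ξ => by
        simp only [map_smul, inner_smul_right]
        exact int_fun_smul μ _ (π.weak_continuous _ _) (π.bound _ _)))
    ‖μ‖ fun η ξ => (norm_int_le μ (π.bound ξ η)).trans_eq (by ring)

/-- The operator `π̃(μ)`, with `⟨π̃(μ)ξ, η⟩ = ∫ ⟨π(x)ξ, η⟩ dμ(x)`; see `inner_tilde`. -/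
def tilde (μ : M S) : π.H →L[ℂ] π.H :=
  ContinuousLinearMap.adjoint (InnerProductSpace.continuousLinearMapOfBilin (π.form μ))

theorem inner_tilde (μ : M S) (ξ η : π.H) :
    inner ℂ η (π.tilde μ ξ) = μ.int fun x => inner ℂ η (π.toFun x ξ) := by
  rw [tilde, ContinuousLinearMap.adjoint_inner_right,
    InnerProductSpace.continuousLinearMapOfBilin_apply]
  rfl

theorem norm_tilde_le (μ : M S) : ‖π.tilde μ‖ ≤ ‖μ‖ := by
  refine ContinuousLinearMap.opNorm_le_bound _ (norm_nonneg _) fun ξ => ?_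
  have h : ‖inner ℂ (π.tilde μ ξ) (π.tilde μ ξ)‖ ≤ ‖π.tilde μ ξ‖ * ‖ξ‖ * ‖μ‖ := by
    rw [inner_tilde]
    exact norm_int_le μ (π.bound ξ _)
  rw [inner_self_eq_norm_sq_to_K] at h
  simp only [norm_pow, RCLike.norm_ofReal, abs_norm] at h
  by_cases h0 : ‖π.tilde μ ξ‖ = 0
  · rw [h0]; positivity
  · have hp : 0 < ‖π.tilde μ ξ‖ := lt_of_le_of_ne (norm_nonneg _) (Ne.symm h0)
    nlinarith

theorem tilde_ext {A B : π.H →L[ℂ] π.H} (h : ∀ ξ η, inner ℂ η (A ξ) = inner ℂ η (B ξ)) :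
    A = B :=
  ContinuousLinearMap.ext fun ξ => ext_inner_left ℂ fun η => h ξ η

theorem tilde_add (μ ν : M S) : π.tilde (μ + ν) = π.tilde μ + π.tilde ν := by
  refine π.tilde_ext fun ξ η => ?_
  rw [inner_tilde, int_add μ ν (π.weak_continuous ξ η) (π.bound ξ η), add_apply,
    inner_add_right, inner_tilde, inner_tilde]

theorem tilde_smul (c : ℂ) (μ : M S) : π.tilde (c • μ) = c • π.tilde μ := by
  refine π.tilde_ext fun ξ η => ?_
  rw [inner_tilde, int_smul c μ (π.weak_continuous ξ η) (π.bound ξ η), smul_apply,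
    inner_smul_right, inner_tilde]

theorem tilde_mul [LocallyCompactSpace S] [ContinuousMul S] (μ ν : M S) :
    π.tilde (μ * ν) = π.tilde μ * π.tilde ν := by
  refine π.tilde_ext fun ξ η => ?_
  rw [inner_tilde, conv_spec μ ν (π.weak_continuous ξ η) (π.bound ξ η)]
  have h : ∀ y, (μ.int fun x => inner ℂ η (π.toFun (x * y) ξ)) =
      inner ℂ (ContinuousLinearMap.adjoint (π.tilde μ) η) (π.toFun y ξ) := fun y => by
    rw [ContinuousLinearMap.adjoint_inner_left, inner_tilde]
    simp only [π.map_mul, mul_apply_eq_comp]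
  simp only [h]
  rw [← inner_tilde, ContinuousLinearMap.adjoint_inner_left, mul_apply_eq_comp]

theorem tilde_star [LocallyCompactSpace S] [ContinuousStar S] (μ : M S) :
    π.tilde (star μ) = star (π.tilde μ) := by
  refine π.tilde_ext fun ξ η => ?_
  rw [inner_tilde, int_star μ (π.weak_continuous ξ η) (π.bound ξ η)]
  have h : ∀ x, conj (inner ℂ η (π.toFun (star x) ξ)) = inner ℂ ξ (π.toFun x η) := fun x => by
    rw [inner_conj_symm, π.map_star, ContinuousLinearMap.adjoint_inner_left]
  simp only [h]
  rw [← inner_tilde, inner_conj_symm, ContinuousLinearMap.star_eq_adjoint,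
    ContinuousLinearMap.adjoint_inner_right]

end StarRep

section CStar

variable [LocallyCompactSpace S] [ContinuousMul S] [ContinuousStar S]

/-- The seminorm `‖μ‖_ρ = sup_{π ∈ ρ} ‖π̃(μ)‖` on `M(S)`; it is `0` for empty `ρ`. -/
def rhoNorm (ρ : Set (StarRep S)) (μ : M S) : ℝ := ⨆ π : ρ, ‖π.1.tilde μ‖

/-- The C*-algebra of bounded families of operators indexed by `ρ`, with the supremum norm. -/
def Ops (ρ : Set (StarRep S)) : Type _ := lp (fun π : ρ => π.1.H →L[ℂ] π.1.H) ∞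

instance (ρ : Set (StarRep S)) : NonUnitalCStarAlgebra (Ops ρ) :=
  inferInstanceAs (NonUnitalCStarAlgebra (lp (fun π : ρ => π.1.H →L[ℂ] π.1.H) ∞))

/-- The `*`-homomorphism `μ ↦ (π̃(μ))_{π ∈ ρ}` from `L(S)` to the bounded families of
operators. -/
def family (ρ : Set (StarRep S)) :
    L S →⋆ₙₐ[ℂ] Ops ρ where
  toFun μ := ⟨fun π => π.1.tilde μ, memℓp_infty ⟨‖(μ : M S)‖, by
    rintro _ ⟨π, rfl⟩
    exact π.1.norm_tilde_le _⟩⟩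
  map_smul' c μ := lp.ext (funext fun π => π.1.tilde_smul c μ)
  map_zero' := lp.ext (funext fun π => by
    have := π.1.tilde_smul 0 (0 : M S)
    rw [zero_smul, zero_smul] at this
    exact this)
  map_add' μ ν := lp.ext (funext fun π => π.1.tilde_add μ ν)
  map_mul' μ ν := lp.ext (funext fun π => π.1.tilde_mul μ ν)
  map_star' μ := lp.ext (funext fun π => π.1.tilde_star μ)

theorem family_apply (ρ : Set (StarRep S)) (μ : L S) (π : ρ) :
    (family ρ μ).1 π = π.1.tilde μ := rfl

theorem norm_family (ρ : Set (StarRep S)) (μ : L S) : ‖family ρ μ‖ = rhoNorm ρ μ :=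
  lp.norm_eq_ciSup _

/-- `N_ρ = {μ ∈ L(S) : ‖μ‖_ρ = 0}`. -/
def N (ρ : Set (StarRep S)) : Submodule ℂ (L S) where
  carrier := {μ | rhoNorm ρ μ = 0}
  zero_mem' := by
    change rhoNorm ρ ((0 : L S) : M S) = 0
    rw [← norm_family, map_zero, norm_zero]
  add_mem' := by
    intro μ ν hμ hν
    change rhoNorm ρ (μ : M S) = 0 at hμ
    change rhoNorm ρ (ν : M S) = 0 at hν
    change rhoNorm ρ ((μ + ν : L S) : M S) = 0
    rw [← norm_family, norm_eq_zero] at *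
    rw [map_add, hμ, hν, add_zero]
  smul_mem' := by
    intro c μ hμ
    change rhoNorm ρ (μ : M S) = 0 at hμ
    change rhoNorm ρ ((c • μ : L S) : M S) = 0
    rw [← norm_family, norm_eq_zero] at *
    rw [map_smul, hμ, smul_zero]

/-- The C*-algebra `C*_ρ(S)`: the completion of `L(S) / N_ρ` in the norm `‖μ + N_ρ‖ = ‖μ‖_ρ`,
realized as the closure of the image of `L(S)` in the bounded families of operators indexed by
`ρ`. It is complete, and `embed` identifies `L(S) / N_ρ` isometrically with a dense subalgebra;
see `norm_embed` and `denseRange_embed`. -/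
def CStarRho (ρ : Set (StarRep S)) : Type _ :=
  (NonUnitalStarAlgHom.range (family ρ)).topologicalClosure

instance (ρ : Set (StarRep S)) : NonUnitalCStarAlgebra (CStarRho ρ) :=
  haveI : IsClosed ((NonUnitalStarAlgHom.range (family ρ)).topologicalClosure :
      Set (Ops ρ)) :=
    NonUnitalStarSubalgebra.isClosed_topologicalClosure _
  inferInstanceAs
    (NonUnitalCStarAlgebra (NonUnitalStarAlgHom.range (family ρ)).topologicalClosure)

/-- The canonical `*`-homomorphism `L(S) → C*_ρ(S)`. -/
def toCStarRho (ρ : Set (StarRep S)) : L S →⋆ₙₐ[ℂ] CStarRho ρ where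
  toFun μ := ⟨family ρ μ, NonUnitalStarSubalgebra.le_topologicalClosure _ ⟨μ, rfl⟩⟩
  map_smul' c μ := Subtype.ext (map_smul (family ρ) c μ)
  map_zero' := Subtype.ext (map_zero (family ρ))
  map_add' μ ν := Subtype.ext (map_add (family ρ) μ ν)
  map_mul' μ ν := Subtype.ext (map_mul (family ρ) μ ν)
  map_star' μ := Subtype.ext (map_star (family ρ) μ)

theorem norm_toCStarRho (ρ : Set (StarRep S)) (μ : L S) : ‖toCStarRho ρ μ‖ = rhoNorm ρ μ :=
  norm_family ρ μ

/-- The inclusion of `L(S) / N_ρ` in its completion `C*_ρ(S)`. -/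
def embed (ρ : Set (StarRep S)) : (L S ⧸ N ρ) →ₗ[ℂ] CStarRho ρ :=
  (N ρ).liftQ (toCStarRho ρ : L S →ₗ[ℂ] CStarRho ρ) fun μ hμ => by
    change toCStarRho ρ μ = 0
    rw [← norm_eq_zero, norm_toCStarRho]
    exact hμ

theorem embed_mk (ρ : Set (StarRep S)) (μ : L S) :
    embed ρ (Submodule.Quotient.mk μ) = toCStarRho ρ μ := rfl

theorem norm_embed (ρ : Set (StarRep S)) (μ : L S) :
    ‖embed ρ (Submodule.Quotient.mk μ)‖ = rhoNorm ρ μ := norm_toCStarRho ρ μ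

theorem embed_injective (ρ : Set (StarRep S)) : Function.Injective (embed ρ) := by
  rw [injective_iff_map_eq_zero]
  intro q
  obtain ⟨μ, rfl⟩ := Submodule.Quotient.mk_surjective _ q
  intro h
  rw [Submodule.Quotient.mk_eq_zero]
  change rhoNorm ρ (μ : M S) = 0
  rw [← norm_embed, h, norm_zero]

theorem denseRange_toCStarRho (ρ : Set (StarRep S)) : DenseRange (toCStarRho ρ) := by
  intro g
  have hg : g.1 ∈ closure (Set.range (family ρ)) := by
    have h : g.1 ∈ closure (NonUnitalStarAlgHom.range (family ρ) : Set (Ops ρ)) := g.2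
    rwa [NonUnitalStarAlgHom.coe_range] at h
  have hi : IsInducing (fun g : CStarRho ρ => (g.1 : Ops ρ)) := IsInducing.subtypeVal
  rw [hi.closure_eq_preimage_closure_image, Set.mem_preimage, ← Set.range_comp]
  exact hg

theorem denseRange_embed (ρ : Set (StarRep S)) : DenseRange (embed ρ) := by
  refine (denseRange_toCStarRho ρ).mono ?_
  rintro _ ⟨μ, rfl⟩
  exact ⟨Submodule.Quotient.mk μ, rfl⟩

variable (S) in
/-- The full semigroup C*-algebra `C*(S) = C*_Σ(S)`. -/
abbrev CStar : Type _ := CStarRho (Set.univ : Set (StarRep S))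

variable (S) in
/-- The canonical map `L(S) → C*(S)`. -/
abbrev toCStar : L S →⋆ₙₐ[ℂ] CStar S := toCStarRho Set.univ

/-- The extension of `π̃` to a `*`-representation of `C*(S)`; see `ext_toCStar`. -/
def StarRep.ext (π : StarRep S) : CStar S →⋆ₙₐ[ℂ] (π.H →L[ℂ] π.H) where
  toFun g := g.1.1 ⟨π, trivial⟩
  map_smul' _ _ := rfl
  map_zero' := rfl
  map_add' _ _ := rfl
  map_mul' _ _ := rfl
  map_star' _ := rfl

theorem StarRep.ext_toCStar (π : StarRep S) (μ : L S) : π.ext (toCStar S μ) = π.tilde μ := rfl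

theorem StarRep.norm_ext_le (π : StarRep S) (g : CStar S) : ‖π.ext g‖ ≤ ‖g‖ :=
  lp.norm_apply_le_norm (by simp) g.1 ⟨π, trivial⟩

/-- `N'_ρ = ⋂_{π ∈ ρ} ker π̃`, a subspace of `C*(S)`. -/
def N' (ρ : Set (StarRep S)) : Submodule ℂ (CStar S) :=
  ⨅ π ∈ ρ, LinearMap.ker (π.ext : CStar S →ₗ[ℂ] (π.H →L[ℂ] π.H))

theorem mem_N' (ρ : Set (StarRep S)) (g : CStar S) : g ∈ N' ρ ↔ ∀ π ∈ ρ, π.ext g = 0 := by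
  simp only [N', Submodule.mem_iInf]
  rfl

end CStar
end Rep

end FoundationSemigroup

end

/-! ### Norm-controlled lifting along `*`-homomorphisms of C*-algebras. -/

section CStarLift

variable {A B : Type*} [NonUnitalCStarAlgebra A] [NonUnitalCStarAlgebra B]

/-! An element of `CStar S` is a bounded family of operators indexed by all of Σ, and an element of
`CStarRho ρ` is such a family indexed by `ρ`; both algebras are closures of the image of L(S). The
homomorphism φ is therefore restriction of families, that is, forgetting the coordinates outside
`ρ`. It sends (π̃(μ)) over Σ to (π̃(μ)) over `ρ`, so by continuity it maps one closure into the
other (`restrictOps_mem`). The coordinate of an element g at π is π̃(g), so φ(g) = 0 says exactly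
that π̃(g) = 0 for every π in `ρ`. This gives the kernel (`restrict_eq_zero_iff`). Uniqueness
follows from density of L(S), because `*`-homomorphisms between C*-algebras are contractive and
hence continuous.

What remains is that φ is onto and isometric modulo its kernel. This is the general fact that a
`*`-homomorphism of C*-algebras has closed range and induces an isometry on the quotient by its
kernel. Contractivity gives ‖φ(g)‖ ≤ ‖g + N'_ρ‖. For the reverse inequality it suffices that every
φ(a) has a preimage of norm at most ‖φ(a)‖ (`NonUnitalStarAlgHom.exists_apply_eq_norm_le`). Such a
preimage comes from cutting a down by functional calculus of a*a: the part of the spectrum of a*a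
above c = ‖φ(a)‖² is invisible to φ, so a may be rescaled there until its square norm is at most c.
Since C*(S)/N'_ρ is complete, its isometric image is closed in C*_ρ(S); it contains the dense image
of L(S), so it is everything (`quotientMap_surjective`). -/

theorem NonUnitalStarAlgHom.continuous_of_cstar (φ : A →⋆ₙₐ[ℂ] B) : Continuous φ :=
  AddMonoidHomClass.continuous_of_bound φ 1 fun a => by
    simpa using NonUnitalStarAlgHom.norm_apply_le φ a

/-- Every element of the range of a `*`-homomorphism of C*-algebras has a preimage which is not
longer than itself. -/
theorem NonUnitalStarAlgHom.exists_apply_eq_norm_le (φ : A →⋆ₙₐ[ℂ] B) (a : A) :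
    ∃ b : A, φ b = φ a ∧ ‖b‖ ≤ ‖φ a‖ := by
  by_cases h0 : φ a = 0
  -- This case must be split off: with c = 0 the function `h` below would be constantly 1, so it
  -- would not vanish at 0 and the non-unital calculus would not accept it.
  · exact ⟨0, by simp [h0], by simp⟩
  set c : ℝ := ‖φ a‖ ^ 2 with hc
  have hcpos : 0 < c := by
    have := norm_pos_iff.2 h0
    positivity
  have hsa : IsSelfAdjoint (star a * a) := IsSelfAdjoint.star_mul_self a
  -- Chosen so that (1 - h(t))² = c / max(t, c). The factor 1 - h is 1 on t ≤ c and scales each t >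
  -- c down to t · (c / t) = c. The calculus is applied to `h` rather than to 1 - h because A may
  -- have no unit and 1 - h does not vanish at 0.
  let h : ℝ → ℝ := fun t => 1 - √(c / max t c)
  have hmax : ∀ t, max t c ≠ 0 := fun t => (lt_of_lt_of_le hcpos (le_max_right t c)).ne'
  have hcont : Continuous h := by
    have : Continuous fun t : ℝ => c / max t c :=
      continuous_const.div (by fun_prop) hmax
    fun_prop
  have hz : ∀ t ≤ c, h t = 0 := fun t ht => by
    simp [h, max_eq_right ht, div_self hcpos.ne']
  have h00 : h 0 = 0 := hz 0 hcpos.le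
  set k : A := cfcₙ h (star a * a) with hk
  have hksa : star k = k := (cfcₙ_predicate h (star a * a) : IsSelfAdjoint _)
  -- Subtracting a·k does not change the image under φ: φ(k) = h(φ(a*a)), and the spectrum of φ(a*a)
  -- lies in the region t ≤ c where `h` is zero.
  have hφk : φ k = 0 := by
    have hsa' : IsSelfAdjoint (φ (star a * a)) := hsa.map φ
    rw [hk, φ.map_cfcₙ h (star a * a) hcont.continuousOn h00 φ.continuous_of_cstar hsa hsa']
    rw [← cfcₙ_zero (R := ℝ) (φ (star a * a))]
    refine cfcₙ_congr fun t ht => hz t ?_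
    have h1 : ‖t‖ ≤ ‖φ (star a * a)‖ :=
      NonUnitalIsometricContinuousFunctionalCalculus.norm_quasispectrum_le
        (𝕜 := ℝ) (φ (star a * a)) ht hsa'
    -- By the C*-identity ‖φ(a)*φ(a)‖ = ‖φ(a)‖², which is why `c` was taken to be the square.
    have h2 : ‖φ (star a * a)‖ = c := by
      rw [map_mul, map_star, CStarRing.norm_star_mul_self, hc, sq]
    exact (le_abs_self t).trans (h2 ▸ h1)
  -- The element a(1 - k), written without a unit.
  refine ⟨a - a * k, by rw [map_sub, map_mul, hφk, mul_zero, sub_zero], ?_⟩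
  -- Everything here is a function of the single self-adjoint element a*a. Both sides are expanded
  -- into the same four terms, which the calculus then matches one by one.
  have hid : star (a - a * k) * (a - a * k) = cfcₙ (fun t => t * (1 - h t) ^ 2) (star a * a) := by
    have e1 : star (a - a * k) * (a - a * k) =
        star a * a - star a * a * k - (k * (star a * a) - k * (star a * a) * k) := by
      rw [star_sub, star_mul, hksa]
      noncomm_ring
    -- The function t(1 - h(t))² vanishes at 0, and so does each summand on the right. Its factors
    -- are kept in the order of the operator product in `e1`, so that the calculus rules for sums
    -- and products reproduce that expression literally.
    have e2 : (fun t : ℝ => t * (1 - h t) ^ 2) =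
        fun t => t - t * h t - (h t * t - h t * t * h t) := by
      funext t; ring
    rw [e1, e2]
    have c1 : ContinuousOn h (quasispectrum ℝ (star a * a)) := hcont.continuousOn
    rw [cfcₙ_sub (fun t => t - t * h t) (fun t => h t * t - h t * t * h t) (star a * a)
      (by fun_prop) (by simp) (by fun_prop) (by simp),
      cfcₙ_sub (fun t => t) (fun t => t * h t) (star a * a)
      (by fun_prop) (by simp) (by fun_prop) (by simp),
      cfcₙ_sub (fun t => h t * t) (fun t => h t * t * h t) (star a * a)
      (by fun_prop) (by simp) (by fun_prop) (by simp),
      cfcₙ_mul (fun t => t) h (star a * a)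
      (by fun_prop) (by simp) (by fun_prop) h00,
      cfcₙ_mul (fun t => h t * t) h (star a * a)
      (by fun_prop) (by simp) (by fun_prop) h00,
      cfcₙ_mul h (fun t => t) (star a * a)
      (by fun_prop) h00 (by fun_prop) (by simp), cfcₙ_id' ℝ (star a * a)]
  have hle : ‖star (a - a * k) * (a - a * k)‖ ≤ c := by
    rw [hid]
    -- A carries no order of its own here; the spectral order is introduced locally, only to know
    -- that the quasispectrum of a*a is nonnegative.
    let _ := CStarAlgebra.spectralOrder A
    have _ := CStarAlgebra.spectralOrderedRing A
    refine norm_cfcₙ_le fun t ht => ?_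
    -- Nonnegativity of t lets the norm of t · c / max(t, c) be replaced by its value. The bound by
    -- c is then just t ≤ max(t, c).
    have ht0 : 0 ≤ t := quasispectrum_nonneg_of_nonneg _ (star_mul_self_nonneg a) t ht
    have hm : 0 < max t c := lt_of_lt_of_le hcpos (le_max_right t c)
    have : (1 - h t) ^ 2 = c / max t c := by
      simp only [h, sub_sub_cancel]
      exact Real.sq_sqrt (by positivity)
    rw [this, Real.norm_of_nonneg (by positivity), mul_div_assoc', div_le_iff₀ hm, mul_comm]
    exact mul_le_mul_of_nonneg_left (le_max_left t c) hcpos.le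
  -- The C*-identity turns the bound on b*b, where b = a - ak, into ‖b‖² ≤ ‖φ(a)‖²; square roots
  -- finish.
  rw [CStarRing.norm_star_mul_self, hc, sq] at hle
  exact (mul_self_le_mul_self_iff (norm_nonneg _) (norm_nonneg _)).2 hle

end CStarLift

namespace FoundationSemigroup

/-! ### Restriction of operator families and the induced isometry on the quotient. -/

section Restriction

variable {S : Type*} [Semigroup S] [StarMul S] [TopologicalSpace S]
    [ContinuousMul S] [ContinuousStar S] [T2Space S] [LocallyCompactSpace S]
    [MeasurableSpace S] [BorelSpace S]

/-- The restriction of bounded families of operators from all representations to those in `ρ`. -/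
noncomputable def restrictOps (ρ : Set (StarRep S)) : Ops (Set.univ : Set (StarRep S)) →⋆ₙₐ[ℂ] Ops ρ where
  toFun g := ⟨fun π => g.1 ⟨π.1, trivial⟩, memℓp_infty ⟨‖g‖, by
    rintro _ ⟨π, rfl⟩
    exact lp.norm_apply_le_norm (by simp) g ⟨π.1, trivial⟩⟩⟩
  map_smul' _ _ := rfl
  map_zero' := rfl
  map_add' _ _ := rfl
  map_mul' _ _ := rfl
  map_star' _ := rfl

/-- A continuous map carries the closure of a set into the closure of its image, and restricting the
family of μ over Σ yields the family of the same μ over `ρ`. Only the continuity that is automatic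
for `*`-homomorphisms is used. -/
theorem restrictOps_mem (ρ : Set (StarRep S)) (g : CStar S) :
    restrictOps ρ g.1 ∈ (NonUnitalStarAlgHom.range (family ρ)).topologicalClosure := by
  refine map_mem_closure (restrictOps ρ).continuous_of_cstar g.2 ?_
  rintro _ ⟨μ, rfl⟩
  exact ⟨μ, rfl⟩

/-- The canonical `*`-homomorphism `C*(S) → C*_ρ(S)`. -/
noncomputable def restrict (ρ : Set (StarRep S)) : CStar S →⋆ₙₐ[ℂ] CStarRho ρ where
  toFun g := ⟨restrictOps ρ g.1, restrictOps_mem ρ g⟩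
  map_smul' _ _ := rfl
  map_zero' := rfl
  map_add' _ _ := rfl
  map_mul' _ _ := rfl
  map_star' _ := rfl

/-- Both sides are the family (π̃(μ)) indexed by `ρ`; this is where the concrete model of the
completions pays off. -/
theorem restrict_toCStar (ρ : Set (StarRep S)) (μ : L S) :
    restrict ρ (toCStar S μ) = toCStarRho ρ μ := rfl

/-- A family of operators vanishes exactly when all its coordinates do, and the coordinate at π of
the restricted family is by definition the extended representation applied to g. No approximation by
elements of L(S) is needed, although N'_ρ may be larger than the closure of the image of N_ρ. -/
theorem restrict_eq_zero_iff (ρ : Set (StarRep S)) (g : CStar S) :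
    restrict ρ g = 0 ↔ g ∈ N' ρ := by
  rw [mem_N']
  constructor
  · intro h π hπ
    exact congrFun (congrArg (fun x : CStarRho ρ => x.1.1) h) ⟨π, hπ⟩
  · intro h
    exact Subtype.ext (lp.ext (funext fun π => h π.1 π.2))

/-- The linear map on `C*(S) / N'_ρ` induced by `restrict`. -/
noncomputable def quotientMap (ρ : Set (StarRep S)) : (CStar S ⧸ N' ρ) →ₗ[ℂ] CStarRho ρ :=
  (N' ρ).liftQ (restrict ρ : CStar S →ₗ[ℂ] CStarRho ρ) fun g hg =>
    (restrict_eq_zero_iff ρ g).2 hg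

theorem quotientMap_mk (ρ : Set (StarRep S)) (g : CStar S) :
    quotientMap ρ (Submodule.Quotient.mk g) = restrict ρ g := rfl

/-- Taken from the kernel and not from the isometry property: isometry gives injectivity only once
the quotient seminorm is known to be a norm. With injectivity in hand, closedness of N'_ρ never has
to be proved separately. -/
theorem quotientMap_injective (ρ : Set (StarRep S)) : Function.Injective (quotientMap ρ) := by
  rw [injective_iff_map_eq_zero]
  intro q hq
  obtain ⟨g, rfl⟩ := Submodule.Quotient.mk_surjective _ q
  exact (Submodule.Quotient.mk_eq_zero _).2 ((restrict_eq_zero_iff ρ g).1 hq)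

/-- The quotient norm is the infimum of the norms of representatives. Contractivity of the
restriction bounds its value by every one of them, and the lifting lemma provides one whose norm
does not exceed that value. -/
theorem norm_quotientMap (ρ : Set (StarRep S)) (q : CStar S ⧸ N' ρ) :
    ‖quotientMap ρ q‖ = ‖q‖ := by
  obtain ⟨g, rfl⟩ := Submodule.Quotient.mk_surjective _ q
  apply le_antisymm
  · refine le_of_forall_pos_le_add fun ε hε => ?_
    -- A representative within ε of the infimum; its image under the restriction is no longer than
    -- it is.
    obtain ⟨g', hg', hn⟩ := Submodule.Quotient.norm_mk_lt
      (Submodule.Quotient.mk g : CStar S ⧸ N' ρ) hε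
    refine le_trans ?_ hn.le
    rw [← hg']
    exact NonUnitalStarAlgHom.norm_apply_le (restrict ρ) g'
  -- The short preimage g' has the same restriction as g, so g - g' lies in the kernel N'_ρ and the
  -- two define the same class.
  · obtain ⟨g', hg', hn⟩ := (restrict ρ).exists_apply_eq_norm_le g
    have : (Submodule.Quotient.mk g : CStar S ⧸ N' ρ) = Submodule.Quotient.mk g' := by
      rw [Submodule.Quotient.eq, ← restrict_eq_zero_iff, map_sub, hg', sub_self]
    calc ‖(Submodule.Quotient.mk g : CStar S ⧸ N' ρ)‖ ≤ ‖g'‖ := by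
          rw [this]; exact Submodule.Quotient.norm_mk_le _ _
      _ ≤ _ := hn

/-- The range is dense because it contains the image of L(S), and closed because it is the isometric
image of a complete space. Thus closedness of the range comes from the norm identity. -/
theorem quotientMap_surjective (ρ : Set (StarRep S)) : Function.Surjective (quotientMap ρ) := by
  let i : (CStar S ⧸ N' ρ) →ₗᵢ[ℂ] CStarRho ρ := ⟨quotientMap ρ, norm_quotientMap ρ⟩
  have hd : DenseRange i := (denseRange_toCStarRho ρ).mono (by
    rintro _ ⟨μ, rfl⟩
    exact ⟨Submodule.Quotient.mk (toCStar S μ), rfl⟩)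
  -- The quotient of the complete space C*(S) is complete, isometries preserve completeness, and
  -- complete subsets of C*_ρ(S) are closed.
  have hcl : IsClosed (Set.range i) := by
    refine IsComplete.isClosed ?_
    rw [← Set.image_univ]
    exact (LinearIsometry.isComplete_image_iff i).2 isComplete_univ
  exact Set.range_eq_univ.1 (hcl.closure_eq ▸ hd.closure_range)

end Restriction

end FoundationSemigroup

/-! ### The main theorem. -/

open FoundationSemigroup in
theorem proposition2p3 {S : Type*} [Semigroup S] [StarMul S] [TopologicalSpace S]
    [ContinuousMul S] [ContinuousStar S] [T2Space S] [LocallyCompactSpace S]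
    [MeasurableSpace S] [BorelSpace S] (ρ : Set (StarRep S)) :
    (∀ μ ∈ N ρ, toCStar S μ ∈ N' ρ) ∧
    ∃ φ : CStar S →⋆ₙₐ[ℂ] CStarRho ρ,
      (∀ μ : L S, φ (toCStar S μ) = embed ρ (Submodule.Quotient.mk μ)) ∧
      Continuous φ ∧
      (∀ ψ : CStar S →⋆ₙₐ[ℂ] CStarRho ρ,
        (∀ μ : L S, ψ (toCStar S μ) = embed ρ (Submodule.Quotient.mk μ)) → ψ = φ) ∧
      (∀ ψ : CStar S → CStarRho ρ, Continuous ψ →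
        (∀ μ : L S, ψ (toCStar S μ) = embed ρ (Submodule.Quotient.mk μ)) → ψ = φ) ∧
      Function.Surjective φ ∧
      (∀ g : CStar S, φ g = 0 ↔ g ∈ N' ρ) ∧
      ∃ e : (CStar S ⧸ N' ρ) ≃ₗᵢ[ℂ] CStarRho ρ,
        ∀ g : CStar S, e (Submodule.Quotient.mk g) = φ g := by
  -- Stated for arbitrary continuous maps, with no algebraic assumption, so that it serves both
  -- uniqueness claims: two continuous maps into a Hausdorff space that agree on the dense image of
  -- L(S) are equal.
  have huniq : ∀ ψ : CStar S → CStarRho ρ, Continuous ψ →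
      (∀ μ : L S, ψ (toCStar S μ) = embed ρ (Submodule.Quotient.mk μ)) → ψ = restrict ρ :=
    fun ψ hψ h => (denseRange_toCStarRho Set.univ).equalizer hψ (restrict ρ).continuous_of_cstar
      (funext h)
  refine ⟨fun μ hμ => ?_, restrict ρ, fun μ => rfl, (restrict ρ).continuous_of_cstar, fun ψ h => ?_, huniq,
    ?_, restrict_eq_zero_iff ρ, ?_⟩
  -- Membership in N'_ρ is vanishing under the restriction, and the restriction of the canonical
  -- image of μ has norm ‖μ‖_ρ, which is 0 on N_ρ.
  · rw [← restrict_eq_zero_iff, restrict_toCStar, ← norm_eq_zero, norm_toCStarRho]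
    exact hμ
  -- A `*`-homomorphism between C*-algebras is automatically continuous, so this is a case of the
  -- uniqueness among continuous maps.
  · exact DFunLike.coe_injective (huniq ψ ψ.continuous_of_cstar h)
  · intro x
    -- Surjectivity of φ is read off from that of the quotient map, since φ factors through the
    -- quotient.
    obtain ⟨q, rfl⟩ := quotientMap_surjective ρ x
    obtain ⟨g, rfl⟩ := Submodule.Quotient.mk_surjective _ q
    exact ⟨g, rfl⟩
  · exact ⟨⟨LinearEquiv.ofBijective (quotientMap ρ)
      ⟨quotientMap_injective ρ, quotientMap_surjective ρ⟩, norm_quotientMap ρ⟩, quotientMap_mk ρ⟩
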